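/- Let $G$ be a countably infinite, connected graph of bounded degree without self-loops, with vertex set $V$; write $N_x$ for the set of neighbours of $x$, fix a vertex $o\in V$, and let $1<p<\infty$ be a real number. For $f:V\to\mathbb R$ put $$I_p(f)=\sum_{x\in V}\sum_{y\in N_x}|f(y)-f(x)|^p,\qquad \Delta_pf(x)=\sum_{y\in N_x}|f(y)-f(x)|^{p-2}(f(y)-f(x)),$$ where a summand of $\Delta_p f(x)$ with $f(y)=f(x)$ is $0$. Let $D_p(G)$ be the space of functions $f$ with $I_p(f)<\infty$, normed by $\|f\|_{D_p}=(I_p(f)+|f(o)|^p)^{1/p}$; let $BD_p(G)$ be the real algebra (under pointwise operations) of bounded functions in $D_p(G)$; and let $BHD_p(G)$ be the set of $h\in BD_p(G)$ with $\Delta_ph(x)=0$ for all $x\in V$. For a set $A\subseteq D_p(G)$ let $B(\overline{A})_{D_p}$ be the set of bounded functions in the $D_p(G)$-closure of $A$. Let $\mathbb RG$ be the set of finitely supported functions $V\to\mathbb R$, and $\ell^p(G)$ the set of $f:V\to\mathbb R$ with $\sum_{x\in V}|f(x)|^p<\infty$. Let $Sp(BD_p(G))$ be the set of characters of $BD_p(G)$,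 that is, nonzero real-algebra homomorphisms $\tau:BD_p(G)\to\mathbb C$; for $f\in BD_p(G)$ put $\hat f(\tau)=\tau(f)$; and let $i(x)$, for $x\in V$, be the character $f\mapsto f(x)$. The $p$-harmonic boundary of $G$ is $$\partial_p(G)=\{\tau\in Sp(BD_p(G))\setminus i(V)\;:\;\hat f(\tau)=0\text{ for all } f\in B(\overline{\mathbb RG})_{D_p}\}.$$ Then: 1. $BHD_p(G)$ contains a nonconstant function if and only if $\partial_p(G)$ has more than one point. 2. For every $f\in BD_p(G)$: $f\in B(\overline{\ell^p(G)})_{D_p}$ if and only if $\hat f(\tau)=0$ for all $\tau\in\partial_p(G)$. -/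

import Mathlib

namespace PHarmonic

noncomputable section

variable {V : Type*} (G : SimpleGraph V) [G.LocallyFinite] (p : ℝ)

/-- The `p`-th power of the gradient, `|Df(x)|^p = ∑_{y ∈ N_x} |f(y) - f(x)|^p`. -/
def gradPow (f : V → ℝ) (x : V) : ℝ :=
  ∑ y ∈ G.neighborFinset x, |f y - f x| ^ p

/-- `f` is `p`-Dirichlet finite: `I_p(f, V) = ∑_{x ∈ V} |Df(x)|^p` converges
(all terms are nonnegative). -/
def IsDirichletFinite (f : V → ℝ) : Prop :=
  Summable (fun x => gradPow G p f x)

/-- The `p`-Dirichlet sum `I_p(f, V)`; used only for `p`-Dirichlet finite `f`. -/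
def dirichletSum (f : V → ℝ) : ℝ :=
  ∑' x, gradPow G p f x

/-- The `p`-Laplacian. A summand with `f y = f x` is zero for every `p`, because of its
second factor. -/
def pLaplacian (f : V → ℝ) (x : V) : ℝ :=
  ∑ y ∈ G.neighborFinset x, |f y - f x| ^ (p - 2) * (f y - f x)

/-- `f` is a bounded function on `V`. -/
def IsBoundedFun (f : V → ℝ) : Prop :=
  ∃ C : ℝ, ∀ x, |f x| ≤ C

/-- The norm of the space `D_p(G)` of `p`-Dirichlet finite functions, with base vertex `o`. -/
def dpNorm (o : V) (f : V → ℝ) : ℝ :=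
  (dirichletSum G p f + |f o| ^ p) ^ (1 / p)

/-- The closure in `D_p(G)`, with respect to its norm, of the set `A ∩ D_p(G)`. -/
def dpClosure (o : V) (A : Set (V → ℝ)) : Set (V → ℝ) :=
  {f | IsDirichletFinite G p f ∧
    ∀ ε : ℝ, 0 < ε → ∃ g ∈ A, IsDirichletFinite G p g ∧ dpNorm G p o (f - g) < ε}

/-- The bounded functions in the `D_p(G)`-closure of `A`. -/
def bddDpClosure (o : V) (A : Set (V → ℝ)) : Set (V → ℝ) :=
  {f | f ∈ dpClosure G p o A ∧ IsBoundedFun f}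

/-- The real-valued functions on `V` with finite support. -/
def finSupp (V : Type*) : Set (V → ℝ) :=
  {f | (Function.support f).Finite}

/-- The functions on `V` with `∑ |f(x)|^p < ∞`. -/
def lpFun (V : Type*) (p : ℝ) : Set (V → ℝ) :=
  {f | Summable (fun x => |f x| ^ p)}

theorem isDirichletFinite_of_le (hp : 1 < p) {f h k : V → ℝ} (C : ℝ) (hC : 0 ≤ C)
    (hf : IsDirichletFinite G p f) (hh : IsDirichletFinite G p h)
    (hk : ∀ x y, |k y - k x| ≤ C * (|f y - f x| + |h y - h x|)) :
    IsDirichletFinite G p k := by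
  refine Summable.of_nonneg_of_le (fun x => Finset.sum_nonneg fun y _ => by positivity)
    (fun x => ?_) ((hf.add hh).mul_left (C ^ p * 2 ^ (p - 1)))
  simp only [gradPow]
  rw [← Finset.sum_add_distrib, Finset.mul_sum]
  refine Finset.sum_le_sum fun y _ => ?_
  calc |k y - k x| ^ p ≤ (C * (|f y - f x| + |h y - h x|)) ^ p :=
        Real.rpow_le_rpow (abs_nonneg _) (hk x y) (by linarith)
    _ = C ^ p * (|f y - f x| + |h y - h x|) ^ p := Real.mul_rpow hC (by positivity)
    _ ≤ C ^ p * (2 ^ (p - 1) * (|f y - f x| ^ p + |h y - h x| ^ p)) := by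
        gcongr
        exact_mod_cast NNReal.rpow_add_le_mul_rpow_add_rpow (‖f y - f x‖₊) (‖h y - h x‖₊) hp.le
    _ = _ := by ring

/-- The algebra `BD_p(G)` of bounded `p`-Dirichlet finite functions, with pointwise
operations. -/
def BD (hp : 1 < p) : Subalgebra ℝ (V → ℝ) where
  carrier := {f | IsDirichletFinite G p f ∧ IsBoundedFun f}
  add_mem' := by
    rintro f h ⟨hf, a, ha⟩ ⟨hh, b, hb⟩
    refine ⟨isDirichletFinite_of_le G p hp 1 zero_le_one hf hh fun x y => ?_,
      a + b, fun x => (abs_add_le _ _).trans (add_le_add (ha x) (hb x))⟩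
    simp only [Pi.add_apply, one_mul]
    calc |f y + h y - (f x + h x)| = |(f y - f x) + (h y - h x)| := by ring_nf
      _ ≤ _ := abs_add_le _ _
  mul_mem' := by
    rintro f h ⟨hf, a, ha⟩ ⟨hh, b, hb⟩
    refine ⟨isDirichletFinite_of_le G p hp (|a| + |b|) (by positivity) hf hh fun x y => ?_,
      |a| * |b|, fun x => ?_⟩
    · have h1 : |f y| ≤ |a| + |b| :=
        (ha y).trans ((le_abs_self a).trans (le_add_of_nonneg_right (abs_nonneg b)))
      have h2 : |h x| ≤ |a| + |b| :=
        (hb x).trans ((le_abs_self b).trans (le_add_of_nonneg_left (abs_nonneg a)))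
      simp only [Pi.mul_apply]
      calc |f y * h y - f x * h x| = |h x * (f y - f x) + f y * (h y - h x)| := by ring_nf
        _ ≤ |h x| * |f y - f x| + |f y| * |h y - h x| := by
          rw [← abs_mul, ← abs_mul]; exact abs_add_le _ _
        _ ≤ (|a| + |b|) * |f y - f x| + (|a| + |b|) * |h y - h x| := by gcongr
        _ = _ := by ring
    · simp only [Pi.mul_apply, abs_mul]
      exact mul_le_mul ((ha x).trans (le_abs_self a)) ((hb x).trans (le_abs_self b))
        (abs_nonneg _) (abs_nonneg _)
  algebraMap_mem' := by
    intro r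
    refine ⟨?_, |r|, fun x => le_of_eq rfl⟩
    have h0 : (0 : ℝ) ^ p = 0 := Real.zero_rpow (by linarith)
    simp [IsDirichletFinite, gradPow, h0, summable_zero]

/-- The set `BHD_p(G)` of bounded `p`-Dirichlet finite functions that are `p`-harmonic on `V`. -/
def BHD (hp : 1 < p) : Set (V → ℝ) :=
  {h | h ∈ BD G p hp ∧ ∀ x, pLaplacian G p h x = 0}

/-- The spectrum `Sp(BD_p(G))`: the nonzero (real-linear, multiplicative) homomorphisms from
the real algebra `BD_p(G)` to the complex numbers. -/
def Spectrum (hp : 1 < p) : Type _ :=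
  {τ : BD G p hp →ₙₐ[ℝ] ℂ // τ ≠ 0}

/-- The Gelfand transform of `f`. -/
def gelfand (hp : 1 < p) (f : BD G p hp) (τ : Spectrum G p hp) : ℂ :=
  τ.1 f

/-- The map `i : V → Sp(BD_p(G))` sending a vertex to the evaluation at that vertex. -/
def evalChar (hp : 1 < p) (x : V) : Spectrum G p hp :=
  ⟨{ toFun := fun f => ((f.1 x : ℝ) : ℂ)
     map_smul' := by intro r f; simp
     map_zero' := by simp
     map_add' := by intro f g; simp
     map_mul' := by intro f g; simp }, by
    intro h
    have h1 := DFunLike.congr_fun h (1 : BD G p hp)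
    simp at h1⟩

/-- The `p`-Royden boundary `Sp(BD_p(G)) \ i(V)`. -/
def roydenBoundary (hp : 1 < p) : Set (Spectrum G p hp) :=
  (Set.range (evalChar G p hp))ᶜ

/-- The `p`-harmonic boundary: the points of the `p`-Royden boundary at which the transforms of
all bounded functions in the `D_p(G)`-closure of the finitely supported functions vanish. -/
def harmonicBoundary (hp : 1 < p) (o : V) : Set (Spectrum G p hp) :=
  {τ | τ ∈ roydenBoundary G p hp ∧
    ∀ f : BD G p hp, (f : V → ℝ) ∈ bddDpClosure G p o (finSupp V) → gelfand G p hp f τ = 0}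

end

end PHarmonic

/-! Write $I$ for the bounded functions in the closure of $\mathbb RG$. With bounded degree the
energy is controlled by the $\ell^p$ sum, and cutting off tails shows that $\ell^p(G)$ and $\mathbb
RG$ have the same closure (`bddDpClosure_lpFun`). The second claim therefore says that $I$ is
exactly the set of functions whose transforms vanish on the boundary.

One inclusion is the definition. For the other, $I$ is an ideal of $BD_p(G)$
(`mul_mem_bddDpClosure`), and $BD_p(G)$ is stable under Lipschitz functions. If $f\notin I$, then
for some $\varepsilon>0$ no $b\in I$ satisfies $|b|\ge 1$ on all of $\{|f|\ge\varepsilon\}$;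
otherwise $f$ minus its truncation at every level would be divisible by an element of $I$. The sets
$\{|f|\ge\varepsilon,\ |b|<1\}$ then generate a proper filter. The limit along an ultrafilter
refining it is a character that kills $I$ but not $f$ (`mem_bddDpClosure_of_ultrafilter`). Such a
character is never an evaluation, since $I$ contains the point indicators.

For the first claim, minimising the energy over $f+\mathbb RG$ splits $f$ into a bounded
$p$-harmonic function plus an element of $I$ (`exists_royden_decomposition`); uniform convexity of
$|t|^p$ makes minimising sequences Cauchy. Two boundary points are separated by some $f$, hence by
its harmonic part, which cannot be constant. Conversely, with at most one boundary point every $h\in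
BD_p(G)$ is a constant plus an element of $I$. If $h$ is harmonic, that element is harmonic and a
limit of finitely supported functions, so Green's formula and convexity force its energy to vanish
(`eq_of_pLaplacian_eq_zero`). -/

namespace PHarmonic

open Filter Topology

/-! ### Inequalities for $|t|^p$ and for sums of $p$-th powers. -/

section Power

variable {p : ℝ} {ι : Type*}

theorem rpow_le_of_abs_le_add (hp : 1 < p) {a b c : ℝ} (h : |c| ≤ |a| + |b|) :
    |c| ^ p ≤ 2 ^ (p - 1) * (|a| ^ p + |b| ^ p) := by
  refine (Real.rpow_le_rpow (abs_nonneg _) h (by linarith)).trans ?_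
  exact_mod_cast NNReal.rpow_add_le_mul_rpow_add_rpow ‖a‖₊ ‖b‖₊ hp.le

theorem summable_rpow_of_abs_le_add (hp : 1 < p) {a b c : ι → ℝ}
    (ha : Summable fun i => |a i| ^ p) (hb : Summable fun i => |b i| ^ p)
    (h : ∀ i, |c i| ≤ |a i| + |b i|) : Summable fun i => |c i| ^ p :=
  Summable.of_nonneg_of_le (fun i => by positivity) (fun i => rpow_le_of_abs_le_add hp (h i))
    ((ha.add hb).mul_left _)

theorem tsum_rpow_le_of_abs_le_add (hp : 1 < p) {a b c : ι → ℝ}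
    (ha : Summable fun i => |a i| ^ p) (hb : Summable fun i => |b i| ^ p)
    (h : ∀ i, |c i| ≤ |a i| + |b i|) :
    ∑' i, |c i| ^ p ≤ 2 ^ (p - 1) * (∑' i, |a i| ^ p + ∑' i, |b i| ^ p) := by
  rw [← ha.tsum_add hb, ← tsum_mul_left]
  exact (summable_rpow_of_abs_le_add hp ha hb h).tsum_le_tsum
    (fun i => rpow_le_of_abs_le_add hp (h i)) ((ha.add hb).mul_left _)

/-- A dominated convergence criterion in `ℓ^p`, the dominating function being perturbed by a
sequence converging to zero in `ℓ^p`. -/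
theorem tendsto_tsum_rpow_zero (hp : 1 < p) {b r : ℕ → ι → ℝ} {c : ι → ℝ}
    (hc : Summable fun i => |c i| ^ p) (hr : ∀ n, Summable fun i => |r n i| ^ p)
    (hr0 : Tendsto (fun n => ∑' i, |r n i| ^ p) atTop (𝓝 0))
    (hb : ∀ n i, |b n i| ≤ |r n i| + |c i|)
    (hb0 : ∀ i, Tendsto (fun n => b n i) atTop (𝓝 0)) :
    Tendsto (fun n => ∑' i, |b n i| ^ p) atTop (𝓝 0) := by
  have hp0 : 0 < p := by linarith
  -- The excess of $|b_n|$ over $|r_n|$ is dominated by the fixed function $|c|$, so ordinary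
  -- dominated convergence applies to it.
  set e : ℕ → ι → ℝ := fun n i => max (|b n i| - |r n i|) 0 with he
  have he0 : ∀ n i, 0 ≤ e n i := fun n i => le_max_right _ _
  have hec : ∀ n i, |e n i| ≤ |c i| := fun n i => by
    rw [abs_of_nonneg (he0 n i)]
    exact max_le (by linarith [hb n i]) (abs_nonneg _)
  have heb : ∀ n i, |e n i| ≤ |b n i| := fun n i => by
    rw [abs_of_nonneg (he0 n i)]
    exact max_le (by linarith [abs_nonneg (r n i)]) (abs_nonneg _)
  have hlim : Tendsto (fun n => ∑' i, |e n i| ^ p) atTop (𝓝 0) := by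
    have := tendsto_tsum_of_dominated_convergence (f := fun n i => |e n i| ^ p)
      (g := fun _ => (0 : ℝ)) (𝓕 := atTop) hc (fun i => ?_)
      (Eventually.of_forall fun n i => ?_)
    · simpa using this
    · have h1 : Tendsto (fun n => |b n i| ^ p) atTop (𝓝 0) := by
        have := ((hb0 i).abs).rpow_const (p := p) (Or.inr hp0.le)
        simpa [Real.zero_rpow hp0.ne'] using this
      exact squeeze_zero (fun n => by positivity)
        (fun n => Real.rpow_le_rpow (abs_nonneg _) (heb n i) hp0.le) h1
    · rw [Real.norm_of_nonneg (by positivity)]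
      exact Real.rpow_le_rpow (abs_nonneg _) (hec n i) hp0.le
  have hes : ∀ n, Summable fun i => |e n i| ^ p := fun n =>
    Summable.of_nonneg_of_le (fun i => by positivity)
      (fun i => Real.rpow_le_rpow (abs_nonneg _) (hec n i) hp0.le) hc
  have hsq := (hr0.add hlim).const_mul ((2 : ℝ) ^ (p - 1))
  simp only [add_zero, mul_zero] at hsq
  refine squeeze_zero (fun n => tsum_nonneg fun i => by positivity) (fun n => ?_) hsq
  refine tsum_rpow_le_of_abs_le_add hp (hr n) (hes n) fun i => ?_
  rw [abs_of_nonneg (he0 n i)]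
  linarith [le_max_left (|b n i| - |r n i|) 0]

theorem abs_rpow_sub_two_mul_self_mul (hp : 1 < p) (a : ℝ) :
    |a| ^ (p - 2) * a * a = |a| ^ p := by
  rcases eq_or_ne a 0 with rfl | ha
  · simp [Real.zero_rpow (by linarith : p ≠ 0)]
  · rw [mul_assoc, ← abs_mul_abs_self a, ← mul_assoc, ← Real.rpow_add_one (abs_ne_zero.2 ha),
      ← Real.rpow_add_one (abs_ne_zero.2 ha)]
    ring_nf

/-- The graph of `|·|^p` lies above its tangents. -/
theorem abs_rpow_add_le (hp : 1 < p) (a c : ℝ) :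
    |a| ^ p + p * (|a| ^ (p - 2) * a * c) ≤ |a + c| ^ p := by
  have hp0 : 0 < p := by linarith
  have hconj : (p / (p - 1)).HolderConjugate p := by
    have := (Real.HolderConjugate.conjExponent hp).symm
    simpa [Real.conjExponent] using this
  -- Young's inequality for $|a|^{p-1}$ and $|a+c|$ with exponents $p/(p-1)$ and $p$.
  have key : |a| ^ (p - 2) * a * (a + c) ≤ |a| ^ p * ((p - 1) / p) + |a + c| ^ p / p := by
    calc |a| ^ (p - 2) * a * (a + c) ≤ |(|a| ^ (p - 2) * a) * (a + c)| := le_abs_self _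
      _ = |a| ^ (p - 1) * |a + c| := by
        rw [abs_mul, abs_mul, abs_of_nonneg (Real.rpow_nonneg (abs_nonneg a) _)]
        congr 1
        rcases eq_or_ne a 0 with rfl | ha
        · simp [Real.zero_rpow (by linarith : p - 1 ≠ 0)]
        · rw [← Real.rpow_add_one (abs_ne_zero.2 ha)]
          ring_nf
      _ ≤ (|a| ^ (p - 1)) ^ (p / (p - 1)) / (p / (p - 1)) + |a + c| ^ p / p :=
        Real.young_inequality_of_nonneg (by positivity) (abs_nonneg _) hconj
      _ = _ := by
        rw [← Real.rpow_mul (abs_nonneg _), mul_div_cancel₀ _ (by linarith : p - 1 ≠ 0)]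
        congr 1
        field_simp
  have h2 := abs_rpow_sub_two_mul_self_mul hp a
  have h3 : p * (|a| ^ (p - 2) * a * (a + c)) ≤ (p - 1) * |a| ^ p + |a + c| ^ p := by
    calc _ ≤ p * (|a| ^ p * ((p - 1) / p) + |a + c| ^ p / p) := by gcongr
      _ = _ := by field_simp
  rw [mul_add, h2] at h3
  linarith

/-- Only $a=0$ needs care, because the first factor is unbounded near it when $p<2$. The product has
modulus $|a|^{p-1}$ for $a\ne 0$, with a positive exponent. -/
theorem continuous_abs_rpow_sub_two_mul (hp : 1 < p) :
    Continuous fun a : ℝ => |a| ^ (p - 2) * a := by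
  refine continuous_iff_continuousAt.2 fun a => ?_
  rcases eq_or_ne a 0 with rfl | ha
  · have h1 : Tendsto (fun a : ℝ => |a| ^ (p - 1)) (𝓝 0) (𝓝 0) := by
      have := (continuous_abs.tendsto (0 : ℝ)).rpow_const (p := p - 1)
        (Or.inr (by linarith))
      simpa [Real.zero_rpow (by linarith : p - 1 ≠ 0)] using this
    have h2 : Tendsto (fun a : ℝ => |a| ^ (p - 2) * a) (𝓝 0) (𝓝 0) := by
      refine squeeze_zero_norm (fun b => ?_) h1
      rw [Real.norm_eq_abs, abs_mul, abs_of_nonneg (Real.rpow_nonneg (abs_nonneg b) _)]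
      rcases eq_or_ne b 0 with rfl | hb
      · simp [Real.rpow_nonneg]
      · rw [← Real.rpow_add_one (abs_ne_zero.2 hb)]
        ring_nf
        exact le_rfl
    simpa [ContinuousAt] using h2
  · exact (continuous_abs.continuousAt.rpow_const (Or.inl (abs_ne_zero.2 ha))).mul
      continuousAt_id

/-- The defect in the midpoint convexity of `|·|^p`. -/
noncomputable def midDefect (p a b : ℝ) : ℝ := (|a| ^ p + |b| ^ p) / 2 - |(a + b) / 2| ^ p

/-- The tangent at the midpoint is evaluated at both endpoints, and the linear terms cancel. -/
theorem midDefect_nonneg (hp : 1 < p) (a b : ℝ) : 0 ≤ midDefect p a b := by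
  have h1 := abs_rpow_add_le hp ((a + b) / 2) ((a - b) / 2)
  have h2 := abs_rpow_add_le hp ((a + b) / 2) ((b - a) / 2)
  rw [show (a + b) / 2 + (a - b) / 2 = a by ring] at h1
  rw [show (a + b) / 2 + (b - a) / 2 = b by ring] at h2
  have h3 : |(a + b) / 2| ^ (p - 2) * ((a + b) / 2) * ((b - a) / 2) =
    -(|(a + b) / 2| ^ (p - 2) * ((a + b) / 2) * ((a - b) / 2)) := by ring
  rw [h3] at h2
  unfold midDefect
  linarith

theorem midDefect_pos (hp : 1 < p) {a b : ℝ} (hab : a ≠ b) : 0 < midDefect p a b := by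
  have hp0 : 0 < p := by linarith
  unfold midDefect
  by_cases h : |a| = |b|
  · have hb : b = -a := by
      rcases abs_eq_abs.1 h with h | h
      · exact absurd h hab
      · linarith
    have ha : a ≠ 0 := by rintro rfl; simp at hb; exact hab hb.symm
    subst hb
    simp only [add_neg_cancel, zero_div, abs_zero, Real.zero_rpow hp0.ne', abs_neg, sub_zero]
    have := abs_pos.2 ha
    positivity
  · have h1 := (strictConvexOn_rpow hp).2 (Set.mem_Ici.2 (abs_nonneg a))
      (Set.mem_Ici.2 (abs_nonneg b)) h (by norm_num : (0 : ℝ) < 1 / 2)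
      (by norm_num : (0 : ℝ) < 1 / 2) (by norm_num)
    simp only [smul_eq_mul] at h1
    have h2 : |(a + b) / 2| ^ p ≤ (1 / 2 * |a| + 1 / 2 * |b|) ^ p := by
      refine Real.rpow_le_rpow (abs_nonneg _) ?_ hp0.le
      rw [abs_div, abs_two]
      linarith [abs_add_le a b]
    linarith

theorem midDefect_mul (s : ℝ) (a b : ℝ) :
    midDefect p (s * a) (s * b) = |s| ^ p * midDefect p a b := by
  unfold midDefect
  rw [show (s * a + s * b) / 2 = s * ((a + b) / 2) by ring, abs_mul, abs_mul, abs_mul,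
    Real.mul_rpow (abs_nonneg _) (abs_nonneg _), Real.mul_rpow (abs_nonneg _) (abs_nonneg _),
    Real.mul_rpow (abs_nonneg _) (abs_nonneg _)]
  ring

/-- Uniform convexity of `|·|^p`. -/
theorem exists_uniform_convexity (hp : 1 < p) {η : ℝ} (hη : 0 < η) :
    ∃ C : ℝ, 0 < C ∧ ∀ a b : ℝ,
      |a - b| ^ p ≤ η * (|a| ^ p + |b| ^ p) + C * midDefect p a b := by
  have hp0 : 0 < p := by linarith
  have hc : ∀ f : ℝ × ℝ → ℝ, Continuous f → Continuous fun z => |f z| ^ p := fun f hf =>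
    hf.abs.rpow_const fun _ => Or.inr hp0.le
  -- By homogeneity the unit sphere suffices. `K` collects the points where the $\eta$ term alone
  -- need not win. There $a\ne b$, so by compactness the defect has a positive lower bound $\delta$.
  set K : Set (ℝ × ℝ) := Metric.sphere 0 1 ∩
    {z | η * (|z.1| ^ p + |z.2| ^ p) ≤ |z.1 - z.2| ^ p} with hK
  have hKc : IsCompact K := (isCompact_sphere _ _).inter_right <|
    isClosed_le (((hc _ continuous_fst).add (hc _ continuous_snd)).const_mul η)
      (hc _ (continuous_fst.sub continuous_snd))
  have hsphere : ∀ z ∈ Metric.sphere (0 : ℝ × ℝ) 1, |z.1| ≤ 1 ∧ |z.2| ≤ 1 := by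
    intro z hz
    have h1 : max |z.1| |z.2| = 1 := by simpa [Prod.norm_def] using hz
    exact ⟨h1 ▸ le_max_left _ _, h1 ▸ le_max_right _ _⟩
  have hδ : ∃ δ : ℝ, 0 < δ ∧ ∀ z ∈ K, δ ≤ midDefect p z.1 z.2 := by
    rcases K.eq_empty_or_nonempty with h | h
    · exact ⟨1, one_pos, by simp [h]⟩
    · have hcont : Continuous fun z : ℝ × ℝ => midDefect p z.1 z.2 :=
        (((hc _ continuous_fst).add (hc _ continuous_snd)).div_const 2).sub
          (hc _ ((continuous_fst.add continuous_snd).div_const 2))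
      obtain ⟨z, hz, hmin⟩ := hKc.exists_isMinOn h hcont.continuousOn
      refine ⟨_, midDefect_pos hp fun h0 => ?_, fun w hw => hmin hw⟩
      have h1 : max |z.1| |z.2| = 1 := by simpa [Prod.norm_def] using hz.1
      have h2 : η * (|z.1| ^ p + |z.2| ^ p) ≤ |z.1 - z.2| ^ p := hz.2
      rw [← h0, max_self] at h1
      rw [← h0, h1, sub_self, abs_zero, Real.zero_rpow hp0.ne', Real.one_rpow] at h2
      linarith
  obtain ⟨δ, hδ0, hδ⟩ := hδ
  have hunit : ∀ z ∈ Metric.sphere (0 : ℝ × ℝ) 1, |z.1 - z.2| ^ p ≤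
      η * (|z.1| ^ p + |z.2| ^ p) + 2 ^ p / δ * midDefect p z.1 z.2 := by
    intro z hz
    by_cases hzK : η * (|z.1| ^ p + |z.2| ^ p) ≤ |z.1 - z.2| ^ p
    · have h1 := hδ z ⟨hz, hzK⟩
      have h2 : |z.1 - z.2| ^ p ≤ 2 ^ p := by
        refine Real.rpow_le_rpow (abs_nonneg _) ?_ hp0.le
        linarith [abs_sub z.1 z.2, (hsphere z hz).1, (hsphere z hz).2]
      have h3 : (2 : ℝ) ^ p ≤ 2 ^ p / δ * midDefect p z.1 z.2 := by
        calc (2 : ℝ) ^ p = 2 ^ p / δ * δ := by field_simp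
          _ ≤ _ := by gcongr
      have : 0 ≤ η * (|z.1| ^ p + |z.2| ^ p) := by positivity
      linarith
    · have := mul_nonneg (by positivity : 0 ≤ 2 ^ p / δ) (midDefect_nonneg hp z.1 z.2)
      linarith
  refine ⟨2 ^ p / δ, by positivity, fun a b => ?_⟩
  rcases eq_or_ne ((a, b) : ℝ × ℝ) 0 with h0 | h0
  · obtain ⟨rfl, rfl⟩ := Prod.mk_eq_zero.1 h0
    have := midDefect_nonneg hp 0 0
    simp only [sub_self, abs_zero, Real.zero_rpow hp0.ne']
    positivity
  · set s := ‖((a, b) : ℝ × ℝ)‖ with hs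
    have hs0 : 0 < s := norm_pos_iff.2 h0
    have h1 := hunit (s⁻¹ • (a, b)) (by
      rw [mem_sphere_zero_iff_norm, norm_smul, norm_inv, norm_norm, inv_mul_cancel₀ hs0.ne'])
    simp only [Prod.smul_mk, smul_eq_mul] at h1
    rw [← mul_sub, midDefect_mul, abs_mul, abs_mul, abs_mul,
      Real.mul_rpow (abs_nonneg _) (abs_nonneg _), Real.mul_rpow (abs_nonneg _) (abs_nonneg _),
      Real.mul_rpow (abs_nonneg _) (abs_nonneg _)] at h1
    have h2 : 0 < |s⁻¹| ^ p := Real.rpow_pos_of_pos (abs_pos.2 (inv_ne_zero hs0.ne')) _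
    refine le_of_mul_le_mul_left (h1.trans (le_of_eq ?_)) h2
    ring

end Power

/-- Truncation of a real number to the interval `[-M, M]`. -/
def clip (M t : ℝ) : ℝ := max (-M) (min M t)

theorem abs_clip_sub_clip_le (M s t : ℝ) : |clip M s - clip M t| ≤ |s - t| := by
  unfold clip
  calc _ ≤ |min M s - min M t| := by
        simpa using abs_max_sub_max_le_max (-M) (min M s) (-M) (min M t)
    _ ≤ |s - t| := by simpa using abs_min_sub_min_le_max M s M t

theorem abs_clip_le {M : ℝ} (hM : 0 ≤ M) (t : ℝ) : |clip M t| ≤ M :=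
  abs_le.2 ⟨le_max_left _ _, max_le (by linarith) (min_le_left _ _)⟩

theorem clip_of_abs_le {M t : ℝ} (h : |t| ≤ M) : clip M t = t := by
  rw [clip, min_eq_right (abs_le.1 h).2, max_eq_right (abs_le.1 h).1]

/-! ### The energy as a sum over ordered pairs of vertices. -/

section

variable {V : Type*} (G : SimpleGraph V) {p : ℝ}

open Classical in
/-- The differential of a function, as a function on pairs of vertices vanishing off the edges. -/
noncomputable def edgeDiff (f : V → ℝ) (e : V × V) : ℝ :=
  if G.Adj e.1 e.2 then f e.2 - f e.1 else 0

theorem edgeDiff_of_adj {f : V → ℝ} {x y : V} (h : G.Adj x y) :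
    edgeDiff G f (x, y) = f y - f x := if_pos h

theorem edgeDiff_of_not_adj {f : V → ℝ} {x y : V} (h : ¬ G.Adj x y) :
    edgeDiff G f (x, y) = 0 := if_neg h

theorem edgeDiff_sub (f g : V → ℝ) (e : V × V) :
    edgeDiff G (f - g) e = edgeDiff G f e - edgeDiff G g e := by
  unfold edgeDiff
  split_ifs
  · simp only [Pi.sub_apply]; ring
  · simp

theorem edgeDiff_add (f g : V → ℝ) (e : V × V) :
    edgeDiff G (f + g) e = edgeDiff G f e + edgeDiff G g e := by
  unfold edgeDiff
  split_ifs
  · simp only [Pi.add_apply]; ring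
  · simp

/-- The `p`-Dirichlet sum as a sum over pairs of vertices. -/
noncomputable def energy (p : ℝ) (f : V → ℝ) : ℝ := ∑' e, |edgeDiff G f e| ^ p

/-- Finiteness of the `p`-Dirichlet sum, as a sum over pairs of vertices. -/
def FiniteEnergy (p : ℝ) (f : V → ℝ) : Prop := Summable fun e => |edgeDiff G f e| ^ p

theorem energy_nonneg (f : V → ℝ) : 0 ≤ energy G p f := tsum_nonneg fun _ => by positivity

theorem FiniteEnergy.mono {f g k : V → ℝ} (hp : 1 < p) (hf : FiniteEnergy G p f)
    (hg : FiniteEnergy G p g)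
    (h : ∀ e, |edgeDiff G k e| ≤ |edgeDiff G f e| + |edgeDiff G g e|) : FiniteEnergy G p k :=
  summable_rpow_of_abs_le_add hp hf hg h

theorem FiniteEnergy.add {f g : V → ℝ} (hp : 1 < p) (hf : FiniteEnergy G p f)
    (hg : FiniteEnergy G p g) : FiniteEnergy G p (f + g) :=
  hf.mono G hp hg fun e => by rw [edgeDiff_add]; exact abs_add_le _ _

theorem FiniteEnergy.sub {f g : V → ℝ} (hp : 1 < p) (hf : FiniteEnergy G p f)
    (hg : FiniteEnergy G p g) : FiniteEnergy G p (f - g) :=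
  hf.mono G hp hg fun e => by rw [edgeDiff_sub]; exact abs_sub _ _

theorem energy_add_le {f g : V → ℝ} (hp : 1 < p) (hf : FiniteEnergy G p f)
    (hg : FiniteEnergy G p g) :
    energy G p (f + g) ≤ 2 ^ (p - 1) * (energy G p f + energy G p g) :=
  tsum_rpow_le_of_abs_le_add hp hf hg fun e => by rw [edgeDiff_add]; exact abs_add_le _ _

theorem rpow_edgeDiff_le_energy {f : V → ℝ} (hf : FiniteEnergy G p f) (e : V × V) :
    |edgeDiff G f e| ^ p ≤ energy G p f :=
  hf.le_tsum e fun _ _ => by positivity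

theorem eq_of_energy_eq_zero (hp : 1 < p) (hconn : G.Connected) {f : V → ℝ}
    (hf : FiniteEnergy G p f) (h0 : energy G p f ≤ 0) (x y : V) : f x = f y := by
  obtain ⟨w⟩ := hconn.preconnected x y
  induction w with
  | nil => rfl
  | @cons a b c h _ ih =>
    refine Eq.trans ?_ ih
    have h1 := (rpow_edgeDiff_le_energy G hf (a, b)).trans h0
    rw [edgeDiff_of_adj G h] at h1
    have h2 := (Real.rpow_eq_zero (abs_nonneg _) (by linarith : p ≠ 0)).1
      (le_antisymm h1 (by positivity))
    linarith [abs_eq_zero.1 h2]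

/-- Convergence in the norm of `D_p(G)` implies pointwise convergence. -/
theorem tendsto_apply_of_energy (hp : 1 < p) (hconn : G.Connected) {o : V} {r : ℕ → V → ℝ}
    (hr : ∀ n, FiniteEnergy G p (r n))
    (hE : Tendsto (fun n => energy G p (r n)) atTop (𝓝 0))
    (ho : Tendsto (fun n => r n o) atTop (𝓝 0)) (x : V) :
    Tendsto (fun n => r n x) atTop (𝓝 0) := by
  have hp0 : 0 < p := by linarith
  obtain ⟨w⟩ := hconn.preconnected x o
  induction w with
  | nil => exact ho
  | @cons a b c h _ ih =>
    have h1 : Tendsto (fun n => r n b - r n a) atTop (𝓝 0) := by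
      have h2 : Tendsto (fun n => (energy G p (r n)) ^ p⁻¹) atTop (𝓝 0) := by
        have := hE.rpow_const (p := p⁻¹) (Or.inr (by positivity))
        simpa [Real.zero_rpow (inv_ne_zero hp0.ne')] using this
      refine squeeze_zero_norm (fun n => ?_) h2
      have h3 := rpow_edgeDiff_le_energy G (hr n) (a, b)
      rw [edgeDiff_of_adj G h] at h3
      rw [Real.norm_eq_abs]
      calc _ = (|r n b - r n a| ^ p) ^ p⁻¹ := by
            rw [← Real.rpow_mul (abs_nonneg _), mul_inv_cancel₀ hp0.ne', Real.rpow_one]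
        _ ≤ _ := Real.rpow_le_rpow (by positivity) h3 (by positivity)
    simpa using (ih ho).sub h1

/-! ### Closures in $D_p(G)$. -/

section LocallyFinite

variable [G.LocallyFinite]

theorem tsum_fiber {φ : V × V → ℝ} (hφ : ∀ x y, ¬ G.Adj x y → φ (x, y) = 0) (x : V) :
    ∑' y, φ (x, y) = ∑ y ∈ G.neighborFinset x, φ (x, y) :=
  tsum_eq_sum fun y hy => hφ x y (by simpa using hy)

theorem summable_fiber {φ : V × V → ℝ} (hφ : ∀ x y, ¬ G.Adj x y → φ (x, y) = 0) (x : V) :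
    Summable fun y => φ (x, y) :=
  summable_of_ne_finset_zero (s := G.neighborFinset x)
    fun y hy => hφ x y (by simpa using hy)

theorem tsum_rpow_edgeDiff (hp : 1 < p) (f : V → ℝ) (x : V) :
    ∑' y, |edgeDiff G f (x, y)| ^ p = gradPow G p f x := by
  rw [tsum_fiber G (φ := fun e => |edgeDiff G f e| ^ p)]
  · refine Finset.sum_congr rfl fun y hy => ?_
    rw [edgeDiff_of_adj G (by simpa using hy)]
  · intro x y h
    simp [edgeDiff_of_not_adj G h, Real.zero_rpow (by linarith : p ≠ 0)]

theorem finiteEnergy_iff (hp : 1 < p) (f : V → ℝ) :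
    FiniteEnergy G p f ↔ IsDirichletFinite G p f := by
  unfold FiniteEnergy IsDirichletFinite
  rw [summable_prod_of_nonneg fun e => by positivity]
  simp only [tsum_rpow_edgeDiff G hp]
  refine and_iff_right fun x => summable_fiber G (φ := fun e => |edgeDiff G f e| ^ p) ?_ x
  intro x y h
  simp [edgeDiff_of_not_adj G h, Real.zero_rpow (by linarith : p ≠ 0)]

theorem energy_eq_dirichletSum (hp : 1 < p) {f : V → ℝ} (hf : FiniteEnergy G p f) :
    energy G p f = dirichletSum G p f := by
  unfold energy dirichletSum
  rw [hf.tsum_prod]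
  simp only [tsum_rpow_edgeDiff G hp]

/-- Passing from $\varepsilon$ to its $p$-th power removes the root in the norm, so that closures
can be handled through sums of $p$-th powers. -/
theorem mem_dpClosure_iff (hp : 1 < p) {o : V} {A : Set (V → ℝ)} {f : V → ℝ} :
    f ∈ dpClosure G p o A ↔ FiniteEnergy G p f ∧ ∀ ε : ℝ, 0 < ε → ∃ g ∈ A, FiniteEnergy G p g ∧
      energy G p (f - g) + |f o - g o| ^ p < ε := by
  have hp0 : 0 < p := by linarith
  unfold dpClosure dpNorm
  simp only [Set.mem_ofPred_eq, ← finiteEnergy_iff G hp, one_div]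
  refine and_congr_right fun hf => ⟨fun h ε hε => ?_, fun h ε hε => ?_⟩
  · obtain ⟨g, hgA, hg, h1⟩ := h (ε ^ p⁻¹) (by positivity)
    refine ⟨g, hgA, hg, ?_⟩
    rw [← energy_eq_dirichletSum G hp (hf.sub G hp hg), Pi.sub_apply] at h1
    exact (Real.rpow_lt_rpow_iff (add_nonneg (energy_nonneg G _) (by positivity)) hε.le
      (by positivity)).1 h1
  · obtain ⟨g, hgA, hg, h1⟩ := h (ε ^ p) (by positivity)
    refine ⟨g, hgA, hg, ?_⟩
    rw [← energy_eq_dirichletSum G hp (hf.sub G hp hg), Pi.sub_apply]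
    calc _ < (ε ^ p) ^ p⁻¹ := Real.rpow_lt_rpow
          (add_nonneg (energy_nonneg G _) (by positivity)) h1 (by positivity)
      _ = ε := by rw [← Real.rpow_mul hε.le, mul_inv_cancel₀ hp0.ne', Real.rpow_one]

theorem mem_dpClosure_iff_tendsto (hp : 1 < p) {o : V} {A : Set (V → ℝ)} {f : V → ℝ} :
    f ∈ dpClosure G p o A ↔ FiniteEnergy G p f ∧ ∃ g : ℕ → V → ℝ,
      (∀ n, g n ∈ A ∧ FiniteEnergy G p (g n)) ∧
      Tendsto (fun n => energy G p (g n - f)) atTop (𝓝 0) ∧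
      Tendsto (fun n => (g n - f) o) atTop (𝓝 0) := by
  have hp0 : 0 < p := by linarith
  have hsymm : ∀ u v : V → ℝ, energy G p (u - v) = energy G p (v - u) := fun u v => by
    unfold energy
    simp only [edgeDiff_sub, abs_sub_comm]
  rw [mem_dpClosure_iff G hp]
  refine and_congr_right fun hf => ⟨fun h => ?_, ?_⟩
  · choose g hgA hg hlt using fun n : ℕ => h (1 / ((n : ℝ) + 1)) Nat.one_div_pos_of_nat
    have h0 : Tendsto (fun n => energy G p (f - g n) + |f o - g n o| ^ p) atTop (𝓝 0) :=
      squeeze_zero (fun n => add_nonneg (energy_nonneg G _) (by positivity))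
        (fun n => (hlt n).le) tendsto_one_div_add_atTop_nhds_zero_nat
    refine ⟨g, fun n => ⟨hgA n, hg n⟩, ?_, ?_⟩
    · refine squeeze_zero (fun n => energy_nonneg G _) (fun n => ?_) h0
      rw [hsymm]
      exact le_add_of_nonneg_right (by positivity)
    · have h1 : Tendsto (fun n => |f o - g n o| ^ p) atTop (𝓝 0) :=
        squeeze_zero (fun n => by positivity)
          (fun n => le_add_of_nonneg_left (energy_nonneg G _)) h0
      have h2 := h1.rpow_const (p := p⁻¹) (Or.inr (by positivity))
      rw [Real.zero_rpow (inv_ne_zero hp0.ne')] at h2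
      refine squeeze_zero_norm (fun n => le_of_eq ?_) h2
      rw [← Real.rpow_mul (abs_nonneg _), mul_inv_cancel₀ hp0.ne', Real.rpow_one,
        Real.norm_eq_abs, abs_sub_comm, Pi.sub_apply]
  · rintro ⟨g, hg, h1, h2⟩ ε hε
    have h3 := h2.abs.rpow_const (p := p) (Or.inr hp0.le)
    rw [abs_zero, Real.zero_rpow hp0.ne'] at h3
    have h4 := h1.add h3
    rw [add_zero] at h4
    obtain ⟨n, hn⟩ := (h4.eventually (gt_mem_nhds hε)).exists
    refine ⟨g n, (hg n).1, (hg n).2, ?_⟩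
    rw [hsymm, abs_sub_comm]
    exact hn

/-- The closure operator of `D_p(G)` is idempotent. -/
theorem mem_dpClosure_of_dpClosure (hp : 1 < p) {o : V} {A B : Set (V → ℝ)} {f : V → ℝ}
    (hAB : A ⊆ dpClosure G p o B) (hf : f ∈ dpClosure G p o A) : f ∈ dpClosure G p o B := by
  rw [mem_dpClosure_iff G hp] at hf ⊢
  refine ⟨hf.1, fun ε hε => ?_⟩
  have hc : (0 : ℝ) < 2 ^ (p - 1) := by positivity
  -- The factor $2^{p-1}$ is the loss in the triangle inequality for $p$-th powers.
  have hε' : 0 < ε / 2 / 2 ^ (p - 1) := by positivity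
  obtain ⟨g, hgA, hg, h1⟩ := hf.2 _ hε'
  obtain ⟨k, hkB, hk, h2⟩ := ((mem_dpClosure_iff G hp).1 (hAB hgA)).2 _ hε'
  refine ⟨k, hkB, hk, ?_⟩
  have h3 := energy_add_le G hp (hf.1.sub G hp hg) (hg.sub G hp hk)
  rw [sub_add_sub_cancel] at h3
  have h4 : |f o - k o| ^ p ≤ 2 ^ (p - 1) * (|f o - g o| ^ p + |g o - k o| ^ p) :=
    rpow_le_of_abs_le_add hp (abs_sub_le _ _ _)
  have h5 := mul_lt_mul_of_pos_left (add_lt_add h1 h2) hc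
  have h6 : 2 ^ (p - 1) * (ε / 2 / 2 ^ (p - 1) + ε / 2 / 2 ^ (p - 1)) = ε := by field_simp; norm_num
  rw [h6] at h5
  linarith

theorem dpClosure_mono {o : V} {A B : Set (V → ℝ)} (hAB : A ⊆ B) :
    dpClosure G p o A ⊆ dpClosure G p o B := fun _ hf =>
  ⟨hf.1, fun ε hε => let ⟨g, hg, h⟩ := hf.2 ε hε; ⟨g, hAB hg, h⟩⟩

theorem finSupp_subset_lpFun (hp : 1 < p) : finSupp V ⊆ lpFun V p := fun f hf => by
  refine summable_of_hasFiniteSupport (Set.Finite.subset hf fun x hx h0 => hx ?_)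
  simp [h0, Real.zero_rpow (by linarith : p ≠ 0)]

open Classical in
/-- On a graph of bounded degree, the energy is controlled by the `ℓ^p` norm. -/
theorem energy_le_of_mem_lpFun (hp : 1 < p) {k : ℕ} (hdeg : ∀ x, G.degree x ≤ k) {f : V → ℝ}
    (hf : f ∈ lpFun V p) : FiniteEnergy G p f ∧
      energy G p f ≤ 2 ^ (p - 1) * (k * ∑' x, |f x| ^ p + k * ∑' x, |f x| ^ p) := by
  have hp0 : p ≠ 0 := by linarith
  have hf : Summable fun x => |f x| ^ p := hf
  -- Each edge difference is split into its two endpoint values. The two parts are exchanged by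
  -- swapping the pair, and each counts $|f(x)|^p$ at most `k` times.
  set a : V × V → ℝ := fun e => if G.Adj e.1 e.2 then f e.1 else 0 with ha
  set b : V × V → ℝ := fun e => if G.Adj e.1 e.2 then f e.2 else 0 with hb
  have hab : ∀ e, b e = a (Equiv.prodComm V V e) := fun e => by
    simp [ha, hb, G.adj_comm]
  have hfib : ∀ x y, ¬ G.Adj x y → |a (x, y)| ^ p = 0 := fun x y h => by
    simp [ha, h, Real.zero_rpow hp0]
  have hsum : ∀ x, ∑' y, |a (x, y)| ^ p ≤ k * |f x| ^ p := fun x => by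
    rw [tsum_fiber G (φ := fun e => |a e| ^ p) hfib]
    calc _ = ∑ y ∈ G.neighborFinset x, |f x| ^ p := by
          refine Finset.sum_congr rfl fun y hy => ?_
          simp [ha, (by simpa using hy : G.Adj x y)]
      _ = G.degree x * |f x| ^ p := by simp
      _ ≤ _ := by gcongr; exact_mod_cast hdeg x
  have hsum' : Summable fun x => ∑' y, |a (x, y)| ^ p :=
    Summable.of_nonneg_of_le (fun x => tsum_nonneg fun _ => by positivity) hsum
      (hf.mul_left _)
  have hA : Summable fun e => |a e| ^ p := by
    rw [summable_prod_of_nonneg fun e => by positivity]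
    exact ⟨fun x => summable_fiber G (φ := fun e => |a e| ^ p) hfib x, hsum'⟩
  have hAle : ∑' e, |a e| ^ p ≤ k * ∑' x, |f x| ^ p := by
    rw [hA.tsum_prod, ← tsum_mul_left]
    exact hsum'.tsum_le_tsum hsum (hf.mul_left _)
  have hB : Summable fun e => |b e| ^ p := by
    simp only [hab]
    exact (Equiv.prodComm V V).summable_iff.2 hA
  have hBle : ∑' e, |b e| ^ p ≤ k * ∑' x, |f x| ^ p := by
    simp only [hab]
    exact ((Equiv.prodComm V V).tsum_eq fun e => |a e| ^ p).trans_le hAle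
  have hle : ∀ e, |edgeDiff G f e| ≤ |a e| + |b e| := fun e => by
    simp only [edgeDiff, ha, hb]
    split_ifs
    · rw [add_comm]; exact abs_sub _ _
    · simp
  refine ⟨summable_rpow_of_abs_le_add hp hA hB hle,
    (tsum_rpow_le_of_abs_le_add hp hA hB hle).trans ?_⟩
  gcongr

theorem finiteEnergy_of_finSupp (hp : 1 < p) (hdeg : ∃ k : ℕ, ∀ x, G.degree x ≤ k) {f : V → ℝ}
    (hf : f ∈ finSupp V) : FiniteEnergy G p f :=
  let ⟨_, hk⟩ := hdeg
  (energy_le_of_mem_lpFun G hp hk (finSupp_subset_lpFun hp hf)).1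

open Classical in
theorem lpFun_subset_dpClosure_finSupp (hp : 1 < p) (hdeg : ∃ k : ℕ, ∀ x, G.degree x ≤ k)
    (o : V) : lpFun V p ⊆ dpClosure G p o (finSupp V) := by
  intro f hf
  have hp0 : p ≠ 0 := by linarith
  obtain ⟨k, hk⟩ := hdeg
  have hf' : Summable fun x => |f x| ^ p := hf
  rw [mem_dpClosure_iff G hp]
  refine ⟨(energy_le_of_mem_lpFun G hp hk hf).1, fun ε hε => ?_⟩
  -- The first summand bounds the energy of the tail; the added 1 accounts for its value at the base
  -- vertex.
  set C : ℝ := 2 ^ (p - 1) * (k + k) + 1 with hC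
  have hC0 : 0 < C := by positivity
  have htail := tendsto_tsum_compl_atTop_zero fun x => |f x| ^ p
  obtain ⟨s, hs⟩ := (htail.eventually (gt_mem_nhds (by positivity : 0 < ε / C))).exists
  set g : V → ℝ := fun x => if x ∈ s then f x else 0 with hg
  have hgs : g ∈ finSupp V := s.finite_toSet.subset fun x hx => by
    by_contra h
    exact hx (if_neg h)
  have hr : (fun x => |(f - g) x| ^ p) =
      Set.indicator {x | x ∉ s} (fun x => |f x| ^ p) := by
    ext x
    by_cases hx : x ∈ s <;> simp [hg, hx, Real.zero_rpow hp0]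
  have hrl : f - g ∈ lpFun V p := by
    change Summable fun x => |(f - g) x| ^ p
    rw [hr]
    exact hf'.indicator _
  have hrs : ∑' x, |(f - g) x| ^ p < ε / C := by
    rw [hr, ← tsum_subtype]
    exact hs
  refine ⟨g, hgs, finiteEnergy_of_finSupp G hp ⟨k, hk⟩ hgs, ?_⟩
  have h1 := (energy_le_of_mem_lpFun G hp hk hrl).2
  have h2 : |(f - g) o| ^ p ≤ ∑' x, |(f - g) x| ^ p :=
    Summable.le_tsum (f := fun x => |(f - g) x| ^ p) hrl o fun _ _ => by positivity
  calc _ ≤ C * ∑' x, |(f - g) x| ^ p := by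
        rw [Pi.sub_apply] at h2
        rw [hC]; linarith
    _ < C * (ε / C) := by gcongr
    _ = ε := by field_simp

/-- The functions `ℓ^p` and the finitely supported functions have the same closure. -/
theorem bddDpClosure_lpFun (hp : 1 < p) (hdeg : ∃ k : ℕ, ∀ x, G.degree x ≤ k) (o : V) :
    bddDpClosure G p o (lpFun V p) = bddDpClosure G p o (finSupp V) := by
  ext f
  exact ⟨fun h => ⟨mem_dpClosure_of_dpClosure G hp
      (lpFun_subset_dpClosure_finSupp G hp hdeg o) h.1, h.2⟩,
    fun h => ⟨dpClosure_mono G (finSupp_subset_lpFun hp) h.1, h.2⟩⟩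

end LocallyFinite

end

/-! ### The ideal of bounded functions in the closure of $\mathbb RG$. -/

section

variable {V : Type*} (G : SimpleGraph V) [G.LocallyFinite] {p : ℝ}

theorem summable_rpow_const_mul {ι : Type*} {a : ι → ℝ} (K : ℝ)
    (ha : Summable fun i => |a i| ^ p) : Summable fun i => |K * a i| ^ p := by
  simp only [abs_mul, Real.mul_rpow (abs_nonneg _) (abs_nonneg _)]
  exact ha.mul_left _

theorem mem_BD_iff (hp : 1 < p) {f : V → ℝ} :
    f ∈ BD G p hp ↔ FiniteEnergy G p f ∧ IsBoundedFun f := by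
  rw [finiteEnergy_iff G hp]
  exact Iff.rfl

theorem mem_BD_of_mem_bddDpClosure (hp : 1 < p) {o : V} {A : Set (V → ℝ)} {f : V → ℝ}
    (hf : f ∈ bddDpClosure G p o A) : f ∈ BD G p hp := ⟨hf.1.1, hf.2⟩

/-- Provides a Lipschitz functional calculus, applied to truncation and to $t\mapsto 1/\max(t,1)$.
-/
theorem comp_mem_BD (hp : 1 < p) {f : V → ℝ} (hf : f ∈ BD G p hp) {φ : ℝ → ℝ} {C : ℝ}
    (hC : 0 ≤ C) (hφ : ∀ s t, |φ s - φ t| ≤ C * |s - t|) : (fun x => φ (f x)) ∈ BD G p hp := by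
  obtain ⟨hf1, M, hM⟩ := hf
  refine ⟨isDirichletFinite_of_le G p hp C hC hf1 hf1 fun x y => (hφ _ _).trans ?_,
    |φ 0| + C * M, fun x => ?_⟩
  · gcongr
    exact le_add_of_nonneg_right (abs_nonneg _)
  · have h1 := hφ (f x) 0
    rw [sub_zero] at h1
    have h2 := abs_sub_abs_le_abs_sub (φ (f x)) (φ 0)
    have h3 := mul_le_mul_of_nonneg_left (hM x) hC
    linarith

theorem exists_nonneg_bound {f : V → ℝ} (hf : IsBoundedFun f) :
    ∃ C : ℝ, 0 ≤ C ∧ ∀ x, |f x| ≤ C :=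
  let ⟨C, hC⟩ := hf
  ⟨|C|, abs_nonneg C, fun x => (hC x).trans (le_abs_self C)⟩

theorem clip_zero {M : ℝ} (hM : 0 ≤ M) : clip M 0 = 0 := clip_of_abs_le (by simpa using hM)

/-- The bounded functions in the closure of the finitely supported functions form an ideal. -/
theorem mul_mem_bddDpClosure (hp : 1 < p) (hconn : G.Connected)
    (hdeg : ∃ k : ℕ, ∀ x, G.degree x ≤ k) {o : V} {f g : V → ℝ}
    (hf : f ∈ bddDpClosure G p o (finSupp V)) (hg : g ∈ BD G p hp) :
    g * f ∈ bddDpClosure G p o (finSupp V) := by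
  have hfg : g * f ∈ BD G p hp := mul_mem hg (mem_BD_of_mem_bddDpClosure G hp hf)
  refine ⟨?_, hfg.2⟩
  obtain ⟨hf1, hfb⟩ := hf
  obtain ⟨M, hM0, hM⟩ := exists_nonneg_bound hfb
  obtain ⟨N, hN0, hN⟩ := exists_nonneg_bound hg.2
  rw [mem_dpClosure_iff_tendsto G hp] at hf1 ⊢
  obtain ⟨hfE, u, hu, huE, huo⟩ := hf1
  have hgE := ((mem_BD_iff G hp).1 hg).1
  have hpt := tendsto_apply_of_energy G hp hconn (fun n => (hu n).2.sub G hp hfE) huE huo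
  -- The approximants of $f$ may be unbounded. Truncating them at a bound of $f$ changes neither $f$
  -- nor the value 0, so the supports stay finite and the product rule gives uniform bounds.
  set k : ℕ → V → ℝ := fun n x => g x * clip M (u n x) with hk
  have hks : ∀ n, k n ∈ finSupp V := fun n => (hu n).1.subset fun x hx hx0 => hx (by
    simp [hk, hx0, clip_zero hM0])
  have hkpt : ∀ x, Tendsto (fun n => (k n - g * f) x) atTop (𝓝 0) := fun x => by
    have h1 := ((hpt x).abs).const_mul N
    rw [abs_zero, mul_zero] at h1
    refine squeeze_zero_norm (fun n => ?_) h1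
    simp only [Pi.sub_apply, Pi.mul_apply, hk, ← mul_sub, Real.norm_eq_abs, abs_mul]
    have := abs_clip_sub_clip_le M (u n x) (f x)
    rw [clip_of_abs_le (hM x)] at this
    exact mul_le_mul (hN x) this (abs_nonneg _) hN0
  refine ⟨((mem_BD_iff G hp).1 hfg).1, k,
    fun n => ⟨hks n, finiteEnergy_of_finSupp G hp hdeg (hks n)⟩, ?_, hkpt o⟩
  -- Truncation preserves pointwise convergence but not obviously convergence in energy. The error
  -- is dominated by $N|D(u_n-f)|$, which tends to 0 in $\ell^p$, plus a fixed $\ell^p$ function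
  -- built from $Df$ and $Dg$.
  refine tendsto_tsum_rpow_zero hp
    (r := fun n e => N * edgeDiff G (u n - f) e)
    (c := fun e => |2 * N * edgeDiff G f e| + |2 * M * edgeDiff G g e|)
    (summable_rpow_of_abs_le_add hp (summable_rpow_const_mul (2 * N) hfE)
      (summable_rpow_const_mul (2 * M) hgE) fun e => ?_)
    (fun n => summable_rpow_const_mul N ((hu n).2.sub G hp hfE)) ?_ ?_ ?_
  · rw [abs_of_nonneg (by positivity)]
  · have := huE.const_mul (|N| ^ p)
    rw [mul_zero] at this
    refine this.congr fun n => ?_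
    rw [energy, ← tsum_mul_left]
    simp only [abs_mul, Real.mul_rpow (abs_nonneg _) (abs_nonneg _)]
  · rintro n ⟨x, y⟩
    by_cases h : G.Adj x y
    · simp only [edgeDiff_of_adj G h, Pi.sub_apply, Pi.mul_apply, hk]
      set a := clip M (u n x)
      set b := clip M (u n y)
      have h1 : |b - a| ≤ |u n y - f y - (u n x - f x)| + |f y - f x| := by
        refine (abs_clip_sub_clip_le _ _ _).trans ?_
        rw [show u n y - u n x = (u n y - f y - (u n x - f x)) + (f y - f x) by ring]
        exact abs_add_le _ _
      have h2 : |a - f x| ≤ 2 * M := by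
        have := abs_sub a (f x)
        linarith [hM x, abs_clip_le hM0 (u n x)]
      have h3 : |b - a - (f y - f x)| ≤
          |u n y - f y - (u n x - f x)| + 2 * |f y - f x| := by
        have := abs_sub (b - a) (f y - f x)
        linarith
      rw [abs_of_nonneg (a := |_| + |_|) (add_nonneg (abs_nonneg _) (abs_nonneg _)),
        abs_mul N, abs_mul (2 * N), abs_mul (2 * M), abs_of_nonneg hN0, abs_of_nonneg (by positivity : 0 ≤ 2 * N),
        abs_of_nonneg (by positivity : 0 ≤ 2 * M)]
      calc |g y * b - g y * f y - (g x * a - g x * f x)|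
          = |g y * (b - a - (f y - f x)) + (a - f x) * (g y - g x)| := by ring_nf
        _ ≤ |g y| * |b - a - (f y - f x)| + |a - f x| * |g y - g x| := by
          rw [← abs_mul, ← abs_mul]; exact abs_add_le _ _
        _ ≤ N * (|u n y - f y - (u n x - f x)| + 2 * |f y - f x|) + 2 * M * |g y - g x| := by
          gcongr
          exact hN y
        _ = _ := by ring
    · simp [edgeDiff_of_not_adj G h]
  · rintro ⟨x, y⟩
    by_cases h : G.Adj x y
    · simp only [edgeDiff_of_adj G h]
      simpa using (hkpt y).sub (hkpt x)
    · simp [edgeDiff_of_not_adj G h]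

theorem add_mem_bddDpClosure (hp : 1 < p) (hdeg : ∃ k : ℕ, ∀ x, G.degree x ≤ k)
    {o : V} {f g : V → ℝ} (hf : f ∈ bddDpClosure G p o (finSupp V))
    (hg : g ∈ bddDpClosure G p o (finSupp V)) : f + g ∈ bddDpClosure G p o (finSupp V) := by
  refine ⟨?_, (add_mem (mem_BD_of_mem_bddDpClosure G hp hf)
    (mem_BD_of_mem_bddDpClosure G hp hg)).2⟩
  have hf1 := hf.1
  have hg1 := hg.1
  rw [mem_dpClosure_iff_tendsto G hp] at hf1 hg1 ⊢
  obtain ⟨hfE, u, hu, huE, huo⟩ := hf1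
  obtain ⟨hgE, v, hv, hvE, hvo⟩ := hg1
  have hsub : ∀ n, u n + v n - (f + g) = (u n - f) + (v n - g) := fun n => by ring
  have hs : ∀ n, u n + v n ∈ finSupp V := fun n =>
    ((hu n).1.union (hv n).1).subset (Function.support_add _ _)
  refine ⟨hfE.add G hp hgE, fun n => u n + v n,
    fun n => ⟨hs n, finiteEnergy_of_finSupp G hp hdeg (hs n)⟩, ?_, ?_⟩
  · have h1 := (huE.add hvE).const_mul ((2 : ℝ) ^ (p - 1))
    rw [add_zero, mul_zero] at h1
    refine squeeze_zero (fun n => energy_nonneg G _) (fun n => ?_) h1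
    rw [hsub]
    exact energy_add_le G hp ((hu n).2.sub G hp hfE) ((hv n).2.sub G hp hgE)
  · simp only [hsub]
    simpa using huo.add hvo

theorem zero_mem_finSupp : (0 : V → ℝ) ∈ finSupp V := by
  simp [finSupp]

theorem finSupp_subset_bddDpClosure (hp : 1 < p) (hdeg : ∃ k : ℕ, ∀ x, G.degree x ≤ k) (o : V) :
    finSupp V ⊆ bddDpClosure G p o (finSupp V) := fun f hf => by
  refine ⟨lpFun_subset_dpClosure_finSupp G hp hdeg o (finSupp_subset_lpFun hp hf), ?_⟩
  have h1 : (Set.range fun x => |f x|).Finite := by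
    refine ((hf.image fun x => |f x|).union (Set.finite_singleton 0)).subset ?_
    rintro _ ⟨x, rfl⟩
    by_cases hx : f x = 0
    · right; simp [hx]
    · exact Or.inl ⟨x, hx, rfl⟩
  obtain ⟨C, hC⟩ := h1.bddAbove
  exact ⟨C, fun x => hC ⟨x, rfl⟩⟩

/-- Removing its small values from a function changes it little in `D_p(G)`. -/
theorem mem_bddDpClosure_of_sub_clip (hp : 1 < p) {o : V} {f : V → ℝ}
    (hf : f ∈ BD G p hp)
    (h : ∀ ε : ℝ, 0 < ε → (fun x => f x - clip ε (f x)) ∈ bddDpClosure G p o (finSupp V)) :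
    f ∈ bddDpClosure G p o (finSupp V) := by
  refine ⟨mem_dpClosure_of_dpClosure G hp (A := bddDpClosure G p o (finSupp V))
    (fun _ hg => hg.1) ?_, hf.2⟩
  have hfE := ((mem_BD_iff G hp).1 hf).1
  set ε : ℕ → ℝ := fun n => 1 / ((n : ℝ) + 1)
  have hε : ∀ n, 0 < ε n := fun n => Nat.one_div_pos_of_nat
  have hε0 : Tendsto ε atTop (𝓝 0) := tendsto_one_div_add_atTop_nhds_zero_nat
  rw [mem_dpClosure_iff_tendsto G hp]
  have hpt : ∀ x, Tendsto (fun n => ((fun x => f x - clip (ε n) (f x)) - f) x) atTop (𝓝 0) :=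
    fun x => squeeze_zero_norm (fun n => by
      simpa using abs_clip_le (hε n).le (f x)) hε0
  refine ⟨hfE, fun n x => f x - clip (ε n) (f x), fun n => ⟨h _ (hε n), ?_⟩, ?_, hpt o⟩
  · exact ((mem_BD_iff G hp).1 (mem_BD_of_mem_bddDpClosure G hp (h _ (hε n)))).1
  -- The error is minus the truncation of $f$ at level $\varepsilon_n$: its differences are
  -- dominated by those of $f$, so no perturbation is needed.
  · refine tendsto_tsum_rpow_zero hp (r := fun _ _ => 0) (c := edgeDiff G f) hfE
      (fun n => by simp [Real.zero_rpow (by linarith : p ≠ 0), summable_zero])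
      (by simp [Real.zero_rpow (by linarith : p ≠ 0)]) ?_ ?_
    · rintro n ⟨x, y⟩
      by_cases h : G.Adj x y
      · simp only [edgeDiff_of_adj G h, Pi.sub_apply, abs_zero, zero_add]
        refine le_trans (le_of_eq ?_) (abs_clip_sub_clip_le (ε n) (f y) (f x))
        rw [← abs_neg]
        ring_nf
      · simp [edgeDiff_of_not_adj G h]
    · rintro ⟨x, y⟩
      by_cases h : G.Adj x y
      · simp only [edgeDiff_of_adj G h]
        simpa using (hpt y).sub (hpt x)
      · simp [edgeDiff_of_not_adj G h]

/-- Composition with this function inverts an element of $BD_p(G)$ on the set where it is at least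
1, without leaving the algebra. -/
theorem one_div_max_lipschitz (s t : ℝ) :
    |1 / max s 1 - 1 / max t 1| ≤ 1 * |s - t| := by
  have hs : 1 ≤ max s 1 := le_max_right _ _
  have ht : 1 ≤ max t 1 := le_max_right _ _
  have hst : |max t 1 - max s 1| ≤ |s - t| := by
    rw [abs_sub_comm s t]
    simpa using abs_max_sub_max_le_max t 1 s 1
  rw [div_sub_div _ _ (by linarith) (by linarith), abs_div, one_mul, mul_one, one_mul,
    abs_of_pos (by positivity : 0 < max s 1 * max t 1)]
  exact (div_le_self (abs_nonneg _) (one_le_mul_of_one_le_of_one_le hs ht)).trans hst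

/-- A function `f` of `BD_p(G)` lies in the ideal if every set `{|f| ≥ ε}` admits an element of the
ideal which is at least `1` in absolute value there. -/
theorem mem_bddDpClosure_of_one_le (hp : 1 < p) (hconn : G.Connected)
    (hdeg : ∃ k : ℕ, ∀ x, G.degree x ≤ k) {o : V} {f : V → ℝ} (hf : f ∈ BD G p hp)
    (h : ∀ ε : ℝ, 0 < ε → ∃ b ∈ bddDpClosure G p o (finSupp V), ∀ x, ε ≤ |f x| → 1 ≤ |b x|) :
    f ∈ bddDpClosure G p o (finSupp V) := by
  refine mem_bddDpClosure_of_sub_clip G hp hf fun ε hε => ?_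
  obtain ⟨b, hb, hb1⟩ := h ε hε
  -- Squaring disposes of the sign of `b`. The function $f$ minus its truncation vanishes off
  -- $\{|f|\ge\varepsilon\}$, where $b^2\ge1$, so it is unchanged by the factor $b^2/\max(b^2,1)$,
  -- which puts it in the ideal.
  have hbb : b * b ∈ bddDpClosure G p o (finSupp V) :=
    mul_mem_bddDpClosure G hp hconn hdeg hb (mem_BD_of_mem_bddDpClosure G hp hb)
  have hinv := comp_mem_BD G hp (mem_BD_of_mem_bddDpClosure G hp hbb)
    (φ := fun t => 1 / max t 1) zero_le_one one_div_max_lipschitz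
  have hfc : (fun x => f x - clip ε (f x)) ∈ BD G p hp :=
    sub_mem hf (comp_mem_BD G hp hf (φ := clip ε) zero_le_one fun s t => by
      rw [one_mul]; exact abs_clip_sub_clip_le ε s t)
  have := mul_mem_bddDpClosure G hp hconn hdeg hbb (mul_mem hfc hinv)
  convert this using 1
  ext x
  simp only [Pi.mul_apply]
  by_cases hx : ε ≤ |f x|
  · have h1 : 1 ≤ b x * b x := by
      rw [← abs_mul_abs_self]
      exact one_le_mul_of_one_le_of_one_le (hb1 x hx) (hb1 x hx)
    rw [max_eq_left h1, mul_assoc, one_div, inv_mul_cancel₀ (by linarith), mul_one]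
  · rw [clip_of_abs_le (le_of_not_ge hx), sub_self, zero_mul, zero_mul]

/-- Membership in the ideal is detected by the limits along ultrafilters. -/
theorem mem_bddDpClosure_of_ultrafilter (hp : 1 < p) (hconn : G.Connected)
    (hdeg : ∃ k : ℕ, ∀ x, G.degree x ≤ k) {o : V} {f : V → ℝ} (hf : f ∈ BD G p hp)
    (h : ∀ U : Ultrafilter V, (∀ b ∈ bddDpClosure G p o (finSupp V), Tendsto b U (𝓝 0)) →
      Tendsto f U (𝓝 0)) :
    f ∈ bddDpClosure G p o (finSupp V) := by
  refine mem_bddDpClosure_of_one_le G hp hconn hdeg hf fun ε hε => ?_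
  by_contra! hcon
  have hsq : ∀ b ∈ bddDpClosure G p o (finSupp V), b * b ∈ bddDpClosure G p o (finSupp V) :=
    fun b hb => mul_mem_bddDpClosure G hp hconn hdeg hb (mem_BD_of_mem_bddDpClosure G hp hb)
  -- Closed under intersection because $b^2+c^2<1$ forces $|b|<1$ and $|c|<1$; proper because `hcon`
  -- supplies a point of each generating set.
  let F : Filter V :=
    { sets := {s | ∃ b ∈ bddDpClosure G p o (finSupp V), ∀ x, ε ≤ |f x| → |b x| < 1 → x ∈ s}
      univ_sets := ⟨0, finSupp_subset_bddDpClosure G hp hdeg o zero_mem_finSupp,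
        fun _ _ _ => trivial⟩
      sets_of_superset := fun ⟨b, hb, hbs⟩ hst => ⟨b, hb, fun x h1 h2 => hst (hbs x h1 h2)⟩
      inter_sets := by
        rintro s t ⟨b, hb, hbs⟩ ⟨c, hc, hct⟩
        refine ⟨b * b + c * c, add_mem_bddDpClosure G hp hdeg (hsq b hb) (hsq c hc),
          fun x hx hlt => ?_⟩
        simp only [Pi.add_apply, Pi.mul_apply] at hlt
        have h1 := (le_abs_self _).trans_lt hlt
        exact ⟨hbs x hx ((sq_lt_one_iff_abs_lt_one _).1
            (by nlinarith [mul_self_nonneg (c x)])),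
          hct x hx ((sq_lt_one_iff_abs_lt_one _).1 (by nlinarith [mul_self_nonneg (b x)]))⟩ }
  have hF : ∀ {s : Set V}, s ∈ F ↔
      ∃ b ∈ bddDpClosure G p o (finSupp V), ∀ x, ε ≤ |f x| → |b x| < 1 → x ∈ s := Iff.rfl
  have hne : F.NeBot := ⟨fun hbot => by
    obtain ⟨b, hb, hbs⟩ := hF.1 (Filter.empty_mem_iff_bot.2 hbot)
    obtain ⟨x, hx1, hx2⟩ := hcon b hb
    exact hbs x hx1 hx2⟩
  have hle : (Ultrafilter.of F : Filter V) ≤ F := Ultrafilter.of_le F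
  have hlim := h (Ultrafilter.of F) fun b hb => by
    rw [Metric.tendsto_nhds]
    intro δ hδ
    -- Rescaling by $\delta^{-1}$ turns $|b|<\delta$ into the condition $|\delta^{-1}b|<1$ that
    -- defines the filter.
    refine hle (hF.2 ⟨(fun _ => δ⁻¹) * b, ?_, fun x _ hlt => ?_⟩)
    · exact mul_mem_bddDpClosure G hp hconn hdeg hb ((BD G p hp).algebraMap_mem δ⁻¹)
    · simp only [Pi.mul_apply, abs_mul, abs_inv, abs_of_pos hδ] at hlt
      rw [inv_mul_lt_iff₀ hδ, mul_one] at hlt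
      simpa using hlt
  have h1 : ∀ᶠ x in (Ultrafilter.of F : Filter V), |f x| < ε := by
    have := (Metric.tendsto_nhds.1 hlim) ε hε
    simpa using this
  have h2 : ∀ᶠ x in (Ultrafilter.of F : Filter V), ε ≤ |f x| :=
    hle (hF.2 ⟨0, finSupp_subset_bddDpClosure G hp hdeg o zero_mem_finSupp,
      fun x hx _ => hx⟩)
  obtain ⟨x, hx1, hx2⟩ := (h1.and h2).exists
  exact absurd hx1 (not_lt.2 hx2)

/-! ### Ultrafilter limits as characters, and the harmonic boundary. -/

theorem exists_tendsto_ultrafilter {ι : Type*} (U : Ultrafilter ι) {f : ι → ℝ} {C : ℝ}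
    (hf : ∀ x, |f x| ≤ C) : ∃ a, |a| ≤ C ∧ Tendsto f U (𝓝 a) := by
  obtain ⟨a, ha, hle⟩ := (isCompact_Icc (a := -C) (b := C)).ultrafilter_le_nhds (U.map f)
    (le_principal_iff.2 (mem_map.2 (Eventually.of_forall fun x => abs_le.1 (hf x))))
  exact ⟨a, abs_le.2 ha, hle⟩

theorem tendsto_limUnder_ultrafilter (U : Ultrafilter V) {f : V → ℝ} (hf : IsBoundedFun f) :
    Tendsto f U (𝓝 (limUnder (U : Filter V) f)) :=
  let ⟨_, hC⟩ := hf
  let ⟨a, _, ha⟩ := exists_tendsto_ultrafilter U hC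
  tendsto_nhds_limUnder ⟨a, ha⟩

/-- The character of `BD_p(G)` taking the limit along an ultrafilter. -/
noncomputable def ultraChar (hp : 1 < p) (U : Ultrafilter V) : Spectrum G p hp :=
  ⟨{ toFun := fun f => ((limUnder (U : Filter V) (f : V → ℝ) : ℝ) : ℂ)
     map_smul' := fun r f => by
      have h := (tendsto_limUnder_ultrafilter U f.2.2).const_mul r
      have : limUnder (U : Filter V) ((r • f : BD G p hp) : V → ℝ) = _ := h.limUnder_eq
      exact (congrArg Complex.ofReal this).trans (by simp)
     map_zero' := by
      have : limUnder (U : Filter V) ((0 : BD G p hp) : V → ℝ) = 0 :=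
        (tendsto_const_nhds (x := (0 : ℝ))).limUnder_eq
      exact congrArg Complex.ofReal this
     map_add' := fun f g => by
      have h := (tendsto_limUnder_ultrafilter U f.2.2).add
        (tendsto_limUnder_ultrafilter U g.2.2)
      have : limUnder (U : Filter V) ((f + g : BD G p hp) : V → ℝ) = _ := h.limUnder_eq
      exact (congrArg Complex.ofReal this).trans (by simp)
     map_mul' := fun f g => by
      have h := (tendsto_limUnder_ultrafilter U f.2.2).mul
        (tendsto_limUnder_ultrafilter U g.2.2)
      have : limUnder (U : Filter V) ((f * g : BD G p hp) : V → ℝ) = _ := h.limUnder_eq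
      exact (congrArg Complex.ofReal this).trans (by simp) }, fun h => by
    have h1 := DFunLike.congr_fun h (1 : BD G p hp)
    have h2 : limUnder (U : Filter V) ((1 : BD G p hp) : V → ℝ) = 1 :=
      (tendsto_const_nhds (x := (1 : ℝ))).limUnder_eq
    have h3 : ((limUnder (U : Filter V) ((1 : BD G p hp) : V → ℝ) : ℝ) : ℂ) = 0 := h1
    rw [h2] at h3
    simp at h3⟩

theorem gelfand_ultraChar (hp : 1 < p) (U : Ultrafilter V) (f : BD G p hp) :
    gelfand G p hp f (ultraChar G hp U) =
      ((limUnder (U : Filter V) (f : V → ℝ) : ℝ) : ℂ) := rfl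

/-- A character vanishing on the ideal is not an evaluation, hence lies in the boundary. -/
theorem mem_harmonicBoundary_iff (hp : 1 < p) (hdeg : ∃ k : ℕ, ∀ x, G.degree x ≤ k) {o : V}
    {τ : Spectrum G p hp} : τ ∈ harmonicBoundary G p hp o ↔
      ∀ f : BD G p hp, (f : V → ℝ) ∈ bddDpClosure G p o (finSupp V) →
        gelfand G p hp f τ = 0 := by
  classical
  refine ⟨fun h => h.2, fun h => ⟨?_, h⟩⟩
  rintro ⟨x, rfl⟩
  -- The indicator of a vertex lies in the ideal, yet evaluation there gives 1.
  have hx : (Pi.single x 1 : V → ℝ) ∈ bddDpClosure G p o (finSupp V) :=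
    finSupp_subset_bddDpClosure G hp hdeg o
      ((Set.finite_singleton x).subset Pi.support_single_subset)
  have h1 : (((Pi.single x 1 : V → ℝ) x : ℝ) : ℂ) = 0 :=
    h ⟨_, mem_BD_of_mem_bddDpClosure G hp hx⟩ hx
  simp at h1

theorem ultraChar_mem_harmonicBoundary (hp : 1 < p) (hdeg : ∃ k : ℕ, ∀ x, G.degree x ≤ k)
    {o : V} {U : Ultrafilter V}
    (hU : ∀ b ∈ bddDpClosure G p o (finSupp V), Tendsto b U (𝓝 0)) :
    ultraChar G hp U ∈ harmonicBoundary G p hp o := by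
  rw [mem_harmonicBoundary_iff G hp hdeg]
  intro f hf
  rw [gelfand_ultraChar, (hU f hf).limUnder_eq, Complex.ofReal_zero]

/-- Characters that are limits along ultrafilters already detect the ideal, so no description of the
whole spectrum is required. -/
theorem mem_bddDpClosure_of_gelfand_eq_zero (hp : 1 < p) (hconn : G.Connected)
    (hdeg : ∃ k : ℕ, ∀ x, G.degree x ≤ k) {o : V} (f : BD G p hp)
    (h : ∀ τ ∈ harmonicBoundary G p hp o, gelfand G p hp f τ = 0) :
    (f : V → ℝ) ∈ bddDpClosure G p o (finSupp V) := by
  refine mem_bddDpClosure_of_ultrafilter G hp hconn hdeg f.2 fun U hU => ?_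
  have h1 := h _ (ultraChar_mem_harmonicBoundary G hp hdeg hU)
  rw [gelfand_ultraChar, Complex.ofReal_eq_zero] at h1
  simpa [h1] using tendsto_limUnder_ultrafilter U f.2.2

/-- If the boundary has at most one point, every function of `BD_p(G)` is the sum of a constant
and an element of the ideal. -/
theorem exists_sub_const_mem_bddDpClosure (hp : 1 < p) (hconn : G.Connected)
    (hdeg : ∃ k : ℕ, ∀ x, G.degree x ≤ k) {o : V}
    (hsub : (harmonicBoundary G p hp o).Subsingleton) {f : V → ℝ} (hf : f ∈ BD G p hp) :
    ∃ c : ℝ, (fun x => f x - c) ∈ bddDpClosure G p o (finSupp V) := by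
  by_cases hex : ∃ U : Ultrafilter V, ∀ b ∈ bddDpClosure G p o (finSupp V), Tendsto b U (𝓝 0)
  · obtain ⟨U₀, hU₀⟩ := hex
    refine ⟨limUnder (U₀ : Filter V) f, mem_bddDpClosure_of_ultrafilter G hp hconn hdeg
      (sub_mem hf ((BD G p hp).algebraMap_mem _)) fun U hU => ?_⟩
    have h1 : gelfand G p hp ⟨f, hf⟩ (ultraChar G hp U) =
        gelfand G p hp ⟨f, hf⟩ (ultraChar G hp U₀) := by
      rw [hsub (ultraChar_mem_harmonicBoundary G hp hdeg hU)
        (ultraChar_mem_harmonicBoundary G hp hdeg hU₀)]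
    rw [gelfand_ultraChar, gelfand_ultraChar, Complex.ofReal_inj] at h1
    have h2 := (tendsto_limUnder_ultrafilter U hf.2).sub_const (limUnder (U₀ : Filter V) f)
    rwa [h1, sub_self] at h2
  -- No ultrafilter kills the ideal, so the criterion holds vacuously and the ideal is all of
  -- $BD_p(G)$.
  · exact ⟨0, mem_bddDpClosure_of_ultrafilter G hp hconn hdeg
      (by simpa using hf) fun U hU => absurd ⟨U, hU⟩ hex⟩

end

/-! ### Energy minimisation and the Royden decomposition. -/

section

variable {V : Type*} (G : SimpleGraph V) {p : ℝ}

theorem edgeDiff_swap (h : V → ℝ) (e : V × V) : edgeDiff G h e.swap = -edgeDiff G h e := by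
  by_cases h1 : G.Adj e.1 e.2
  · simp [edgeDiff, h1, h1.symm]
  · have h2 : ¬ G.Adj e.2 e.1 := fun h => h1 h.symm
    simp [edgeDiff, h1, h2]

theorem energy_clip_le (hp : 1 < p) {f : V → ℝ} (hf : FiniteEnergy G p f) (M : ℝ) :
    FiniteEnergy G p (fun x => clip M (f x)) ∧
      energy G p (fun x => clip M (f x)) ≤ energy G p f := by
  have h : ∀ e, |edgeDiff G (fun x => clip M (f x)) e| ≤ |edgeDiff G f e| := fun e => by
    unfold edgeDiff
    split_ifs
    · exact abs_clip_sub_clip_le _ _ _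
    · exact le_rfl
  have hp' : ∀ e, |edgeDiff G (fun x => clip M (f x)) e| ^ p ≤ |edgeDiff G f e| ^ p :=
    fun e => Real.rpow_le_rpow (abs_nonneg _) (h e) (by linarith)
  have hs : FiniteEnergy G p (fun x => clip M (f x)) :=
    Summable.of_nonneg_of_le (fun e => by positivity) hp' hf
  exact ⟨hs, Summable.tsum_le_tsum hp' hs hf⟩

theorem edgeDiff_midpoint (f g : V → ℝ) (e : V × V) :
    edgeDiff G (fun x => (f x + g x) / 2) e = (edgeDiff G f e + edgeDiff G g e) / 2 := by
  unfold edgeDiff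
  split_ifs <;> ring

/-- Allows the pointwise uniform convexity estimate to be summed over edges: the total defect is
small once both energies are near the infimum and the midpoint is admissible. -/
theorem hasSum_midDefect (hp : 1 < p) {f g : V → ℝ} (hf : FiniteEnergy G p f)
    (hg : FiniteEnergy G p g) :
    HasSum (fun e => midDefect p (edgeDiff G f e) (edgeDiff G g e))
      ((energy G p f + energy G p g) / 2 - energy G p (fun x => (f x + g x) / 2)) := by
  have hmid : FiniteEnergy G p (fun x => (f x + g x) / 2) := hf.mono G hp hg fun e => by
    rw [edgeDiff_midpoint, abs_div, abs_two]
    have := abs_add_le (edgeDiff G f e) (edgeDiff G g e)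
    linarith [abs_nonneg (edgeDiff G f e + edgeDiff G g e)]
  have h1 := ((Summable.hasSum hf).add (Summable.hasSum hg)).div_const 2
  have h2 := h1.sub (Summable.hasSum hmid)
  simp only [edgeDiff_midpoint] at h2
  simp only [energy, midDefect, edgeDiff_midpoint]
  exact h2

/-- By uniform convexity, a minimising sequence is Cauchy for the energy seminorm. -/
theorem energy_sub_lt_of_minimizing (hp : 1 < p) {f : V → ℝ} {m : ℝ} {h : ℕ → V → ℝ}
    (hm : ∀ k, f - k ∈ finSupp V → m ≤ energy G p k)
    (hh : ∀ n, f - h n ∈ finSupp V ∧ FiniteEnergy G p (h n))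
    (hlim : Tendsto (fun n => energy G p (h n)) atTop (𝓝 m)) {ε : ℝ} (hε : 0 < ε) :
    ∃ N, ∀ i ≥ N, ∀ j ≥ N, energy G p (h i - h j) ≤ ε := by
  have hm0 : 0 ≤ m := ge_of_tendsto' hlim fun n => energy_nonneg G _
  -- Chosen so that two energies below $m+1$ contribute at most $\varepsilon/2$. The margin
  -- $\varepsilon/(2C)$ below makes the defect term at most $\varepsilon/2$, since the midpoint has
  -- energy at least $m$.
  set η : ℝ := ε / (4 * (m + 1)) with hη
  obtain ⟨C, hC0, hC⟩ := exists_uniform_convexity hp (by positivity : 0 < η)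
  have hlt : m < m + min 1 (ε / (2 * C)) := lt_add_of_pos_right _ (by positivity)
  obtain ⟨N, hN⟩ := eventually_atTop.1 (hlim.eventually (gt_mem_nhds hlt))
  refine ⟨N, fun i hi j hj => ?_⟩
  have hi1 := hN i hi
  have hj1 := hN j hj
  have hle1 := min_le_left (1 : ℝ) (ε / (2 * C))
  have hle2 := min_le_right (1 : ℝ) (ε / (2 * C))
  have hmid : m ≤ energy G p (fun x => (h i x + h j x) / 2) := by
    refine hm _ (((hh i).1.union (hh j).1).subset fun x hx => ?_)
    by_contra hcon
    simp only [Set.mem_union, Function.mem_support, Pi.sub_apply, not_or, not_not] at hcon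
    refine hx ?_
    simp only [Pi.sub_apply]
    linarith [hcon.1, hcon.2]
  have hd := hasSum_midDefect G hp (hh i).2 (hh j).2
  have hsum := (((Summable.hasSum (hh i).2).add (Summable.hasSum (hh j).2)).mul_left η).add
    (hd.mul_left C)
  have hs : FiniteEnergy G p (h i - h j) :=
    (hh i).2.mono G hp (hh j).2 fun e => by rw [edgeDiff_sub]; exact abs_sub _ _
  have hle := hasSum_le (fun e => by rw [edgeDiff_sub]; exact hC _ _) hs.hasSum hsum
  change energy G p (h i - h j) ≤ η * (energy G p (h i) + energy G p (h j)) + _ at hle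
  have h1 : η * (energy G p (h i) + energy G p (h j)) ≤ ε / 2 := by
    calc _ ≤ η * (2 * (m + 1)) := by gcongr; linarith
      _ = ε / 2 := by rw [hη]; field_simp; norm_num
  have h2 : C * ((energy G p (h i) + energy G p (h j)) / 2 -
      energy G p (fun x => (h i x + h j x) / 2)) ≤ ε / 2 := by
    calc _ ≤ C * (ε / (2 * C)) := by gcongr; linarith
      _ = ε / 2 := by field_simp
  linarith

/-- Lower semicontinuity of the energy under pointwise convergence. -/
theorem energy_le_of_tendsto (hp : 1 < p) {ι : Type*} {l : Filter ι} [l.NeBot]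
    {k : ι → V → ℝ} {g : V → ℝ} {ε : ℝ} (hk : ∀ x, Tendsto (fun i => k i x) l (𝓝 (g x)))
    (hfin : ∀ i, FiniteEnergy G p (k i)) (hE : ∀ᶠ i in l, energy G p (k i) ≤ ε) :
    FiniteEnergy G p g ∧ energy G p g ≤ ε := by
  have hpart : ∀ s : Finset (V × V), ∑ e ∈ s, |edgeDiff G g e| ^ p ≤ ε := fun s => by
    have hlim : Tendsto (fun i => ∑ e ∈ s, |edgeDiff G (k i) e| ^ p) l
        (𝓝 (∑ e ∈ s, |edgeDiff G g e| ^ p)) := by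
      refine tendsto_finsetSum _ fun e _ => ?_
      refine Tendsto.rpow_const (Tendsto.abs ?_) (Or.inr (by linarith))
      unfold edgeDiff
      split_ifs
      · exact (hk _).sub (hk _)
      · exact tendsto_const_nhds
    refine le_of_tendsto hlim (hE.mono fun i hi => le_trans ?_ hi)
    exact (hfin i).sum_le_tsum s fun _ _ => by positivity
  have hs : FiniteEnergy G p g := summable_of_sum_le (fun e => by positivity) hpart
  exact ⟨hs, hs.tsum_le_of_sum_le hpart⟩

variable [G.LocallyFinite]

/-- Green's formula. -/
theorem hasSum_green (p : ℝ) (h : V → ℝ) {g : V → ℝ} (hg : g ∈ finSupp V) :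
    HasSum (fun e => |edgeDiff G h e| ^ (p - 2) * edgeDiff G h e * edgeDiff G g e)
      (-2 * ∑' x, pLaplacian G p h x * g x) := by
  set Φ : V × V → ℝ := fun e => |edgeDiff G h e| ^ (p - 2) * edgeDiff G h e with hΦ
  -- `Φ` is antisymmetric under reversal of the pair, so $\Phi\,Dg$ is minus `A` minus its swap.
  -- Both have the same sum, whence the factor $-2$.
  set A : V × V → ℝ := fun e => Φ e * g e.1 with hA
  have hΦ0 : ∀ x y, ¬ G.Adj x y → Φ (x, y) = 0 := fun x y hxy => by
    simp [hΦ, edgeDiff_of_not_adj G hxy]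
  have hA0 : ∀ x y, ¬ G.Adj x y → A (x, y) = 0 := fun x y hxy => by
    simp [hA, hΦ0 x y hxy]
  have hfin : (Function.support A).Finite := by
    refine (Set.Finite.biUnion hg fun x _ =>
      ((G.neighborFinset x).finite_toSet.image (Prod.mk x))).subset ?_
    rintro ⟨x, y⟩ hxy
    simp only [Set.mem_iUnion]
    refine ⟨x, fun h0 => hxy ?_, y, ?_, rfl⟩
    · simp [hA, h0]
    · by_contra hn
      exact hxy (hA0 x y (by simpa using hn))
  have hAs : Summable A := summable_of_hasFiniteSupport hfin
  have hAt : ∑' e, A e = ∑' x, pLaplacian G p h x * g x := by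
    rw [hAs.tsum_prod' fun x => summable_fiber G hA0 x]
    refine tsum_congr fun x => ?_
    rw [tsum_fiber G hA0, pLaplacian, Finset.sum_mul]
    refine Finset.sum_congr rfl fun y hy => ?_
    simp only [hA, hΦ, edgeDiff_of_adj G (by simpa using hy : G.Adj x y)]
  have h1 : HasSum (fun e => -A (Equiv.prodComm V V e) - A e) (-(∑' e, A e) - ∑' e, A e) :=
    (((Equiv.prodComm V V).hasSum_iff.2 hAs.hasSum).neg).sub hAs.hasSum
  rw [hAt] at h1
  convert h1 using 1
  · ext ⟨x, y⟩
    have h2 : Φ (y, x) = -Φ (x, y) := by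
      have := edgeDiff_swap G h (x, y)
      simp only [Prod.swap_prod_mk] at this
      simp only [hΦ, this, abs_neg]
      ring
    simp only [hA, Equiv.prodComm_apply, Prod.swap_prod_mk, h2]
    by_cases hxy : G.Adj x y
    · rw [edgeDiff_of_adj G hxy (f := g)]
      ring
    · change Φ (x, y) * _ = _
      simp [hΦ0 x y hxy]
  · ring

/-- Sums the tangent inequality over all ordered pairs, with Green's formula evaluating the linear
term. It serves both for uniqueness and for the Euler–Lagrange equation. -/
theorem energy_sub_le_energy_add (hp : 1 < p) {h g : V → ℝ} (hg : g ∈ finSupp V)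
    (hh : FiniteEnergy G p h) (hhg : FiniteEnergy G p (h + g)) :
    energy G p h - 2 * p * ∑' x, pLaplacian G p h x * g x ≤ energy G p (h + g) := by
  have h1 := (hasSum_green G p h hg).mul_left p
  refine le_trans (le_of_eq ?_)
    (hasSum_le (fun e => ?_) (Summable.hasSum hh |>.add h1) hhg.hasSum)
  · change _ = energy G p h + _
    ring
  · rw [edgeDiff_add]
    exact abs_rpow_add_le hp _ _

theorem pLaplacian_sub_const (p : ℝ) (h : V → ℝ) (c : ℝ) (x : V) :
    pLaplacian G p (fun y => h y - c) x = pLaplacian G p h x := by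
  simp [pLaplacian]

/-- A `p`-harmonic function in the closure of the finitely supported functions is constant. -/
theorem eq_of_pLaplacian_eq_zero (hp : 1 < p) (hconn : G.Connected)
    (hdeg : ∃ k : ℕ, ∀ x, G.degree x ≤ k) {o : V} {w : V → ℝ}
    (hw : w ∈ dpClosure G p o (finSupp V)) (h0 : ∀ x, pLaplacian G p w x = 0) (x y : V) :
    w x = w y := by
  obtain ⟨hwE, g, hg, hgE, -⟩ := (mem_dpClosure_iff_tendsto G hp).1 hw
  refine eq_of_energy_eq_zero G hp hconn hwE (ge_of_tendsto' hgE fun n => ?_) x y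
  -- Perturbing `w` by $-g_n$ costs nothing to first order, so the energy of `w` is at most that of
  -- $w-g_n$, which tends to 0.
  have hneg : -g n ∈ finSupp V := by simpa [finSupp] using (hg n).1
  have h1 := energy_sub_le_energy_add G hp hneg hwE
    (hwE.add G hp (finiteEnergy_of_finSupp G hp hdeg hneg))
  simp only [h0, zero_mul, tsum_zero, mul_zero, sub_zero] at h1
  refine h1.trans (le_of_eq ?_)
  unfold energy
  refine tsum_congr fun e => ?_
  rw [← sub_eq_add_neg, edgeDiff_sub, edgeDiff_sub, abs_sub_comm]

/-- A bounded minimising sequence for the energy in the class `f + finSupp V`. -/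
theorem exists_minimizing_seq (hp : 1 < p) (hdeg : ∃ k : ℕ, ∀ x, G.degree x ≤ k) {f : V → ℝ}
    (hf : FiniteEnergy G p f) {M : ℝ} (hM0 : 0 ≤ M) (hM : ∀ x, |f x| ≤ M) :
    ∃ (m : ℝ) (h : ℕ → V → ℝ), (∀ k, f - k ∈ finSupp V → m ≤ energy G p k) ∧
      (∀ n, f - h n ∈ finSupp V ∧ FiniteEnergy G p (h n) ∧ ∀ x, |h n x| ≤ M) ∧
      Tendsto (fun n => energy G p (h n)) atTop (𝓝 m) := by
  set S : Set ℝ := energy G p '' {k | f - k ∈ finSupp V} with hS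
  have hbdd : BddBelow S := ⟨0, by rintro _ ⟨k, -, rfl⟩; exact energy_nonneg G k⟩
  have hne : S.Nonempty := ⟨_, f, by simpa using zero_mem_finSupp, rfl⟩
  have hlow : ∀ k, f - k ∈ finSupp V → sInf S ≤ energy G p k :=
    fun k hk => csInf_le hbdd ⟨k, hk, rfl⟩
  have hfin : ∀ k, f - k ∈ finSupp V → FiniteEnergy G p k := fun k hk => by
    simpa using hf.sub G hp (finiteEnergy_of_finSupp G hp hdeg hk)
  have hex : ∀ n : ℕ, ∃ k, f - k ∈ finSupp V ∧
      energy G p k < sInf S + 1 / ((n : ℝ) + 1) := fun n => by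
    obtain ⟨_, ⟨k, hk, rfl⟩, hlt⟩ := exists_lt_of_csInf_lt hne
      (lt_add_of_pos_right (sInf S) (Nat.one_div_pos_of_nat : 0 < 1 / ((n : ℝ) + 1)))
    exact ⟨k, hk, hlt⟩
  choose k hk hlt using hex
  -- Truncation at a bound of $f$ fixes each value where $k_n=f$, so the competitor stays in the
  -- class, and its energy does not increase.
  have hkc : ∀ n, (f - fun x => clip M (k n x)) ∈ finSupp V := fun n =>
    (hk n).subset fun x hx hx0 => hx (by
      have : k n x = f x := by
        have : f x - k n x = 0 := hx0
        linarith
      simp [this, clip_of_abs_le (hM x)])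
  refine ⟨sInf S, fun n x => clip M (k n x), hlow,
    fun n => ⟨hkc n, hfin _ (hkc n), fun x => abs_clip_le hM0 _⟩, ?_⟩
  refine tendsto_of_tendsto_of_tendsto_of_le_of_le tendsto_const_nhds (h := fun n : ℕ =>
    sInf S + 1 / ((n : ℝ) + 1)) ?_ (fun n => hlow _ (hkc n)) fun n =>
      ((energy_clip_le G hp (hfin _ (hk n)) M).2.trans (hlt n).le)
  simpa using (tendsto_one_div_add_atTop_nhds_zero_nat (𝕜 := ℝ)).const_add (sInf S)

theorem continuous_pLaplacian (hp : 1 < p) (x : V) :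
    Continuous fun h : V → ℝ => pLaplacian G p h x :=
  continuous_finsetSum _ fun y _ =>
    (continuous_abs_rpow_sub_two_mul hp).comp ((continuous_apply y).sub (continuous_apply x))

/-- The pointwise limit of a minimising sequence is `p`-harmonic. -/
theorem pLaplacian_eq_zero_of_minimizing (hp : 1 < p) (hdeg : ∃ k : ℕ, ∀ x, G.degree x ≤ k)
    {f : V → ℝ} {m : ℝ} {h : ℕ → V → ℝ} {g : V → ℝ} {l : Filter ℕ} [l.NeBot] (hl : l ≤ atTop)
    (hm : ∀ k, f - k ∈ finSupp V → m ≤ energy G p k)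
    (hh : ∀ n, f - h n ∈ finSupp V ∧ FiniteEnergy G p (h n))
    (hlim : Tendsto (fun n => energy G p (h n)) atTop (𝓝 m))
    (hg : ∀ x, Tendsto (fun n => h n x) l (𝓝 (g x))) (x : V) : pLaplacian G p g x = 0 := by
  classical
  have hcont := continuous_pLaplacian G hp x
  -- The tangent inequality is used at the perturbed function $h_n+t\delta_x$, stepping back by
  -- $-t$. The perturbed energy is at least $m$, so in the limit only the linear term remains and no
  -- remainder has to be estimated.
  have key : ∀ t : ℝ, t * pLaplacian G p (g + Pi.single x t) x ≤ 0 := fun t => by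
    have hs : ∀ s : ℝ, (Pi.single x s : V → ℝ) ∈ finSupp V := fun s =>
      (Set.finite_singleton x).subset Pi.support_single_subset
    have hstep : ∀ n, m + 2 * p * (t * pLaplacian G p (h n + Pi.single x t) x) ≤
        energy G p (h n) := fun n => by
      have hk : f - (h n + Pi.single x t) ∈ finSupp V := by
        rw [← sub_sub]
        exact ((hh n).1.union (hs t)).subset (Function.support_sub _ _)
      have hadd : h n + Pi.single x t + Pi.single x (-t) = h n := by
        rw [add_assoc, ← Pi.single_add]; simp
      have h1 := energy_sub_le_energy_add G hp (hs (-t))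
        ((hh n).2.add G hp (finiteEnergy_of_finSupp G hp hdeg (hs t)))
        (by rw [hadd]; exact (hh n).2)
      rw [hadd, tsum_eq_single x fun y hy => by simp [hy], Pi.single_eq_same] at h1
      linarith [hm _ hk]
    have hlim1 : Tendsto (fun n => m + 2 * p * (t * pLaplacian G p (h n + Pi.single x t) x)) l
        (𝓝 (m + 2 * p * (t * pLaplacian G p (g + Pi.single x t) x))) := by
      refine (((hcont.tendsto _).comp ?_).const_mul t |>.const_mul (2 * p)).const_add m
      exact (tendsto_pi_nhds.2 hg).add_const _
    have h2 := le_of_tendsto_of_tendsto' hlim1 (hlim.mono_left hl) hstep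
    have h3 : 2 * p * (t * pLaplacian G p (g + Pi.single x t) x) ≤ 2 * p * 0 := by linarith
    exact le_of_mul_le_mul_left h3 (by linarith)
  have hL : Tendsto (fun t : ℝ => pLaplacian G p (g + Pi.single x t) x) (𝓝 0)
      (𝓝 (pLaplacian G p g x)) := by
    have hc : Continuous fun t : ℝ => pLaplacian G p (g + Pi.single x t) x :=
      hcont.comp (continuous_const.add (continuous_single (A := fun _ : V => ℝ) x))
    simpa using hc.tendsto 0
  refine le_antisymm ?_ ?_
  · refine le_of_tendsto (hL.mono_left (nhdsWithin_le_nhds (s := Set.Ioi 0))) ?_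
    filter_upwards [self_mem_nhdsWithin] with t ht
    exact nonpos_of_mul_nonpos_right (key t) ht
  · refine ge_of_tendsto (hL.mono_left (nhdsWithin_le_nhds (s := Set.Iio 0))) ?_
    filter_upwards [self_mem_nhdsWithin] with t ht
    exact nonneg_of_mul_nonpos_right (key t) ht

/-- The `p`-Royden decomposition of a bounded function. -/
theorem exists_royden_decomposition (hp : 1 < p) (hdeg : ∃ k : ℕ, ∀ x, G.degree x ≤ k) (o : V)
    {f : V → ℝ} (hf : f ∈ BD G p hp) :
    ∃ g ∈ BHD G p hp, f - g ∈ bddDpClosure G p o (finSupp V) := by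
  have hfE := ((mem_BD_iff G hp).1 hf).1
  obtain ⟨M, hM0, hM⟩ := exists_nonneg_bound hf.2
  obtain ⟨m, h, hm, hh, hlim⟩ := exists_minimizing_seq G hp hdeg hfE hM0 hM
  -- The uniform bound gives a limit at every vertex along an ultrafilter, replacing a diagonal
  -- subsequence.
  let U : Ultrafilter ℕ := Ultrafilter.of atTop
  have hU : (U : Filter ℕ) ≤ atTop := Ultrafilter.of_le _
  choose g hgM hg using fun x => exists_tendsto_ultrafilter U (fun n => (hh n).2.2 x)
  have hh' : ∀ n, f - h n ∈ finSupp V ∧ FiniteEnergy G p (h n) :=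
    fun n => ⟨(hh n).1, (hh n).2.1⟩
  -- With $n$ fixed, the Cauchy estimate for $h_n-h_j$ passes to the limit in $j$ by lower
  -- semicontinuity.
  have hclose : ∀ ε : ℝ, 0 < ε → ∀ᶠ n in (U : Filter ℕ), FiniteEnergy G p (h n - g) ∧
      energy G p (h n - g) ≤ ε := fun ε hε => by
    obtain ⟨N, hN⟩ := energy_sub_lt_of_minimizing G hp hm hh' hlim hε
    refine hU ((eventually_ge_atTop N).mono fun n hn => ?_)
    exact energy_le_of_tendsto G hp (l := (U : Filter ℕ)) (k := fun j => h n - h j)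
      (fun x => (hg x).const_sub (h n x)) (fun j => (hh' n).2.sub G hp (hh' j).2)
      (hU ((eventually_ge_atTop N).mono fun j hj => hN n hn j hj))
  have hgE : FiniteEnergy G p g := by
    obtain ⟨n, hn⟩ := (hclose 1 one_pos).exists
    simpa using (hh' n).2.sub G hp hn.1
  have hgBD : g ∈ BD G p hp := (mem_BD_iff G hp).2 ⟨hgE, M, hgM⟩
  refine ⟨g, ⟨hgBD, pLaplacian_eq_zero_of_minimizing G hp hdeg hU hm hh' hlim hg⟩, ?_,
    (sub_mem hf hgBD).2⟩
  rw [mem_dpClosure_iff G hp]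
  refine ⟨hfE.sub G hp hgE, fun ε hε => ?_⟩
  have ho : Tendsto (fun n => |h n o - g o| ^ p) U (𝓝 0) := by
    have := ((hg o).sub_const (g o)).abs.rpow_const (p := p) (Or.inr (by linarith))
    simpa [Real.zero_rpow (by linarith : p ≠ 0)] using this
  obtain ⟨n, hn1, hn2⟩ := ((hclose (ε / 2) (by positivity)).and
    (ho.eventually (gt_mem_nhds (by positivity : 0 < ε / 2)))).exists
  refine ⟨f - h n, (hh n).1, hfE.sub G hp (hh' n).2, ?_⟩
  have h1 : f - g - (f - h n) = h n - g := by ring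
  have h2 : (f - g) o - (f - h n) o = h n o - g o := by simp
  rw [h1, h2]
  linarith [hn1.2]

/-! ### Characters and nonconstant harmonic functions. -/

theorem spectrum_ext (hp : 1 < p) {τ₁ τ₂ : Spectrum G p hp}
    (h : ∀ f : BD G p hp, gelfand G p hp f τ₁ = gelfand G p hp f τ₂) : τ₁ = τ₂ := by
  have h1 : τ₁.1 = τ₂.1 := NonUnitalAlgHom.ext fun f => h f
  exact Subtype.ext h1

theorem gelfand_sub (hp : 1 < p) (f g : BD G p hp) (τ : Spectrum G p hp) :
    gelfand G p hp (f - g) τ = gelfand G p hp f τ - gelfand G p hp g τ :=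
  map_sub τ.1 f g

/-- The value at 1 is an idempotent of $\mathbb C$, and if it were 0 the character would vanish
identically. -/
theorem spectrum_apply_one (hp : 1 < p) (τ : Spectrum G p hp) : τ.1 1 = 1 := by
  have h1 : τ.1 1 * τ.1 1 = τ.1 1 := by rw [← map_mul, mul_one]
  rcases eq_or_ne (τ.1 1) 0 with h0 | h0
  · refine absurd (NonUnitalAlgHom.ext fun f => ?_) τ.2
    rw [← mul_one f, map_mul, h0, mul_zero]
    rfl
  · exact mul_left_cancel₀ h0 (h1.trans (mul_one _).symm)

theorem gelfand_const (hp : 1 < p) (τ : Spectrum G p hp) {f : BD G p hp} {c : ℝ}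
    (hf : ∀ x, (f : V → ℝ) x = c) : gelfand G p hp f τ = c := by
  have h1 : f = c • (1 : BD G p hp) := Subtype.ext (funext fun x => by simp [hf x])
  rw [h1, gelfand, map_smul, spectrum_apply_one]
  simp

/-- `BHD_p(G)` contains a nonconstant function if and only if the boundary has more than one point. -/
theorem exists_nonconstant_iff (hp : 1 < p) (hconn : G.Connected)
    (hdeg : ∃ k : ℕ, ∀ x, G.degree x ≤ k) (o : V) :
    (∃ h ∈ BHD G p hp, ¬ ∃ c : ℝ, ∀ x, h x = c) ↔
      1 < (harmonicBoundary G p hp o).encard := by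
  refine ⟨fun ⟨h, hh, hnc⟩ => ?_, fun hlt => ?_⟩
  · by_contra hcon
    obtain ⟨c, hc⟩ := exists_sub_const_mem_bddDpClosure G hp hconn hdeg
      (Set.encard_le_one_iff_subsingleton.1 (not_lt.1 hcon)) hh.1
    refine hnc ⟨h o, fun x => ?_⟩
    have := eq_of_pLaplacian_eq_zero G hp hconn hdeg hc.1
      (fun x => by rw [pLaplacian_sub_const, hh.2]) x o
    linarith
  · obtain ⟨τ₁, τ₂, h1, h2, hne⟩ := Set.one_lt_encard_iff.1 hlt
    obtain ⟨f, hf⟩ : ∃ f : BD G p hp, gelfand G p hp f τ₁ ≠ gelfand G p hp f τ₂ := by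
      by_contra! hcon
      exact hne (spectrum_ext G hp hcon)
    obtain ⟨g, hg, hfg⟩ := exists_royden_decomposition G hp hdeg o f.2
    set g' : BD G p hp := ⟨g, hg.1⟩ with hg'
    -- A function and its harmonic part differ by an element of the ideal, so they agree on the
    -- boundary.
    have key : ∀ τ ∈ harmonicBoundary G p hp o,
        gelfand G p hp f τ = gelfand G p hp g' τ := fun τ hτ => by
      have h3 : gelfand G p hp (f - g') τ = 0 := hτ.2 _ hfg
      rwa [gelfand_sub, sub_eq_zero] at h3
    refine ⟨g, hg, fun ⟨c, hc⟩ => hf ?_⟩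
    rw [key _ h1, key _ h2, gelfand_const G hp τ₁ hc, gelfand_const G hp τ₂ hc]

end

end PHarmonic

theorem theorem4p9 {V : Type*} [Countable V] [Infinite V] (G : SimpleGraph V) [G.LocallyFinite]
    (hconn : G.Connected) (hdeg : ∃ k : ℕ, ∀ x, G.degree x ≤ k) (o : V) (p : ℝ) (hp : 1 < p) :
    ((∃ h ∈ PHarmonic.BHD G p hp, ¬ ∃ c : ℝ, ∀ x, h x = c) ↔
      1 < (PHarmonic.harmonicBoundary G p hp o).encard) ∧
    (∀ f : PHarmonic.BD G p hp,
      (f : V → ℝ) ∈ PHarmonic.bddDpClosure G p o (PHarmonic.lpFun V p) ↔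
        ∀ τ ∈ PHarmonic.harmonicBoundary G p hp o, PHarmonic.gelfand G p hp f τ = 0) := by
  refine ⟨PHarmonic.exists_nonconstant_iff G hp hconn hdeg o, fun f => ?_⟩
  rw [PHarmonic.bddDpClosure_lpFun G hp hdeg]
  exact ⟨fun hf τ hτ => hτ.2 f hf,
    PHarmonic.mem_bddDpClosure_of_gelfand_eq_zero G hp hconn hdeg f⟩
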